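/- **Minimax lower bounds for manifold estimation.** For a closed set $S\subset\mathbb R^D$ let $\tau_S\in[0,\infty]$ be its reach, i.e. the infimum of the distance to $S$ over the points of $\mathbb R^D$ having at least two nearest neighbours in $S$ (so $\tau_\emptyset=\infty$). For integers $1\le d\le D$ and $\tau_{\min},\tau_{\partial,\min}\in(0,\infty]$ let $\mathcal M^{d,D}_{\tau_{\min},\tau_{\partial,\min}}$ be the set of compact connected $d$-dimensional $\mathcal C^2$-submanifolds $M\subset\mathbb R^D$ with (possibly empty) boundary $\partial M$ such that $\tau_M\ge\tau_{\min}$ and $\tau_{\partial M}\ge\tau_{\partial,\min}$. For $0<f_{\min}\le f_{\max}<\infty$ let $\mathcal P^{d,D}_{\tau_{\min},\tau_{\partial,\min}}(f_{\min},f_{\max})$ be the set of Borel probability measures $P$ on $\mathbb R^D$ with support $M\in\mathcal M^{d,D}_{\tau_{\min},\tau_{\partial,\min}}$ that have a density $f$ with respect to the $d$-dimensional Hausdorff measure restricted to $M$ with $f_{\min}\le f(x)\le f_{\max}$ for all $x\in M$. Let $\mathrm{d_H}$ be the Hausdorff distance. For every integer $d\ge1$ there are constants $c_d,c'_d,C_d>0$,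 depending only on $d$, such that for all $D\geq d$ and $0<f_{\min}\le f_{\max}<\infty$ the following hold. (i) Let $0<\tau_{\min}<\infty$ with $f_{\min}\le c_d/\tau_{\min}^d$ and $c'_d/\tau_{\min}^d\le f_{\max}$. If $d<D$, then for all $n\ge1$, $$\inf_{\hat M}\ \sup_{P}\ \mathbb E_{P^n}\bigl[\mathrm{d_H}(M,\hat M)\bigr]\ \ge\ C_d\,\tau_{\min}\Bigl\{1\wedge\Bigl(\frac1{f_{\min}\tau_{\min}^d\,n}\Bigr)^{2/d}\Bigr\},$$ where the supremum is over the $P\in\mathcal P^{d,D}_{\tau_{\min},\infty}(f_{\min},f_{\max})$ whose support $M$ has empty boundary. (ii) Let $0<\tau_{\partial,\min}<\infty$ with $f_{\min}\le c_d/\tau_{\partial,\min}^d$ and $c'_d/\tau_{\partial,\min}^d\le f_{\max}$. Then for all $\tau_{\min}\in(0,\infty]$ and all $n\ge1$, $$\inf_{\hat M}\ \sup_{P\in\mathcal P^{d,D}_{\tau_{\min},\tau_{\partial,\min}}(f_{\min},f_{\max})}\ \mathbb E_{P^n}\bigl[\mathrm{d_H}(M,\hat M)\bigr]\ \ge\ C_d\,\tau_{\partial,\min}\Bigl\{1\wedge\Bigl(\frac1{f_{\min}\tau_{\partial,\min}^d\,n}\Bigr)^{2/(d+1)}\Bigr\}.$$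 In both cases $M=\mathrm{Supp}(P)$, and the infimum is over all estimators $\hat M=\hat M(X_1,\dots,X_n)$, where $X_1,\dots,X_n$ are i.i.d. with law $P$. -/

import Mathlib

open MeasureTheory Set
open scoped ENNReal

noncomputable section

namespace ManifoldEstimation

/-- The ambient Euclidean space `ℝ^D`. -/
abbrev Ambient (D : ℕ) : Type := EuclideanSpace ℝ (Fin D)

/-- The model flat piece `ℝ^d × {0}^{D-d}` of `ℝ^D`. -/
def flat (d D : ℕ) : Set (Ambient D) :=
  {x | ∀ i : Fin D, d ≤ i.val → x i = 0}

/-- The model half-flat `ℝ^{d-1} × ℝ_+ × {0}^{D-d}` of `ℝ^D`: the coordinate of (zero-based)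
index `d - 1` is nonnegative. -/
def halfFlat (d D : ℕ) : Set (Ambient D) :=
  {x | x ∈ flat d D ∧ ∀ i : Fin D, i.val + 1 = d → 0 ≤ x i}

/-- `Ψ` is a `C²`-diffeomorphism from an open neighbourhood `Ψ.source` of `0` onto an open
neighbourhood `Ψ.target` of `p`, with `Ψ 0 = p`, that maps the part of the model set `N` lying in
the source onto the part of `M` lying in the target. -/
def IsLocalModel {D : ℕ} (N M : Set (Ambient D)) (p : Ambient D)
    (Ψ : OpenPartialHomeomorph (Ambient D) (Ambient D)) : Prop :=
  (0 : Ambient D) ∈ Ψ.source ∧ Ψ 0 = p ∧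
    ContDiffOn ℝ 2 Ψ Ψ.source ∧ ContDiffOn ℝ 2 Ψ.symm Ψ.target ∧
    Ψ '' (Ψ.source ∩ N) = M ∩ Ψ.target

/-- The set `Int M` of interior points of `M`. -/
def interiorPoints (d : ℕ) {D : ℕ} (M : Set (Ambient D)) : Set (Ambient D) :=
  {p | p ∈ M ∧ ∃ Ψ, IsLocalModel (flat d D) M p Ψ}

/-- The (differential) boundary `∂M` of `M`. -/
def boundaryPoints (d : ℕ) {D : ℕ} (M : Set (Ambient D)) : Set (Ambient D) :=
  {p | p ∈ M ∧ ∃ Ψ, IsLocalModel (halfFlat d D) M p Ψ}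

/-- `M` is a `d`-dimensional `C²`-submanifold with (possibly empty) boundary of `ℝ^D`. -/
def IsSubmanifoldWithBoundary (d : ℕ) {D : ℕ} (M : Set (Ambient D)) : Prop :=
  IsClosed M ∧ ∀ p ∈ M, p ∈ interiorPoints d M ∨ p ∈ boundaryPoints d M

/-- The medial axis of `S`: the points with at least two nearest neighbours on `S`. -/
def medialAxis {D : ℕ} (S : Set (Ambient D)) : Set (Ambient D) :=
  {z | ∃ x ∈ S, ∃ y ∈ S, x ≠ y ∧ dist z x = Metric.infDist z S ∧ dist z y = Metric.infDist z S}

/-- The reach of `S`, in `[0, ∞]`; it is `∞` when the medial axis is empty. -/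
def reach {D : ℕ} (S : Set (Ambient D)) : ℝ≥0∞ :=
  ⨅ z ∈ medialAxis S, Metric.infEDist z S

/-- The geometric model: compact connected `d`-dimensional `C²`-submanifolds of `ℝ^D` with
boundary whose reach, and the reach of whose boundary, are bounded below. The value `∞` is allowed
for both bounds. -/
def geometricModel (d D : ℕ) (τ τb : ℝ≥0∞) : Set (Set (Ambient D)) :=
  {M | IsCompact M ∧ IsConnected M ∧ IsSubmanifoldWithBoundary d M ∧
    τ ≤ reach M ∧ τb ≤ reach (boundaryPoints d M)}

/-- The statistical model: probability distributions whose support is in the geometric model and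
which have a density between `fmin` and `fmax` with respect to the `d`-dimensional Hausdorff
measure on their support. -/
def statisticalModel (d D : ℕ) (τ τb : ℝ≥0∞) (fmin fmax : ℝ) : Set (Measure (Ambient D)) :=
  {P | IsProbabilityMeasure P ∧ P.support ∈ geometricModel d D τ τb ∧
    ∃ f : Ambient D → ℝ, Measurable f ∧ (∀ x ∈ P.support, fmin ≤ f x ∧ f x ≤ fmax) ∧
      P = ((Measure.euclideanHausdorffMeasure d).restrict P.support).withDensity
        (fun x => ENNReal.ofReal (f x))}

/-- The distributions of a model whose support is a manifold without boundary. -/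
def boundaryless (d : ℕ) {D : ℕ} (Model : Set (Measure (Ambient D))) : Set (Measure (Ambient D)) :=
  {P | P ∈ Model ∧ boundaryPoints d P.support = ∅}

/-- The law `P^n` of an i.i.d. sample of size `n` from `P`. -/
def sampleLaw {D : ℕ} (P : Measure (Ambient D)) (n : ℕ) : Measure (Fin n → Ambient D) :=
  Measure.pi fun _ => P

/-- An estimator of the support based on `n` observations: a set-valued map on samples whose
Hausdorff loss is measurable under `P^n` for each `P` of the model, so that the risk makes sense.
Every Borel map into the compact sets with the Hausdorff distance is of this kind. -/
def IsEstimator {D : ℕ} (Model : Set (Measure (Ambient D))) (n : ℕ)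
    (Mhat : (Fin n → Ambient D) → Set (Ambient D)) : Prop :=
  ∀ P ∈ Model, AEMeasurable (fun x => Metric.hausdorffEDist P.support (Mhat x)) (sampleLaw P n)

/-- The expected Hausdorff loss of the estimator `Mhat` of the support of `P`. -/
def risk {D : ℕ} (P : Measure (Ambient D)) (n : ℕ)
    (Mhat : (Fin n → Ambient D) → Set (Ambient D)) : ℝ≥0∞ :=
  ∫⁻ x, Metric.hausdorffEDist P.support (Mhat x) ∂(sampleLaw P n)

/-- The minimax Hausdorff risk for the estimation of the support over the class `Model` from `n`
observations: infimum over estimators of the worst-case expected loss. -/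
def minimaxRisk {D : ℕ} (Model : Set (Measure (Ambient D))) (n : ℕ) : ℝ≥0∞ :=
  ⨅ (Mhat : (Fin n → Ambient D) → Set (Ambient D)) (_ : IsEstimator Model n Mhat),
    ⨆ P ∈ Model, risk P n Mhat

end ManifoldEstimation

end

/-!
The lower bounds follow from Le Cam's two-point method. If two members of the geometric model
coincide outside a set `U`, and if each of them has area at most `1 / (2 n fmin)` in `U`, then they
carry distributions of density `fmin` in `U` and constant density off `U` whose `n`-samples have a
common minorant of mass at least `1 / 2`. The maximal risk is then at least a quarter of the
Hausdorff distance of the two supports (`hausdorffEDist_div_four_le_of_diff_eq`).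

The two supports are built from `F x = ‖x‖² - R² - ψ x` with `R = 2 τ`, once with `ψ = 0` and once
with `ψ` a smooth bump of width `δ` and height of order `δ²` at a pole of the sphere of radius `R`.
Without boundary the supports are the level sets `{F = 0}` in `ℝ^(d+1)`; with boundary they are the
sublevel sets `{F ≤ 0}` in `ℝ^d`. The second derivative of `ψ` is small against that of `‖x‖²`, so
`F` is convex and its gradient does not vanish on `{F = 0}`. Consequently:

* the sublevel set is convex, hence of infinite reach, and its frontier `{F = 0}` is
  homeomorphic to a sphere, hence connected in dimension at least two;
* by the inverse function theorem `F` is, up to sign, a coordinate of a `C²` chart, which provides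
  the local models (`exists_straightening`); that the differential boundary contains nothing else is
  a dimension count on derivatives (`disjoint_interiorPoints_boundaryPoints`);
* the reach of `{F = 0}` is at least `τ`, by Lagrange multipliers and the second-order Taylor bound
  (`ofReal_le_reach_zeroSet`).

The Hausdorff distance of the two supports is of order `δ² / τ`
(`IsSmallBump.le_hausdorffEDist`). They differ by a set of area of order `δ^d` without boundary, as
both are Lipschitz graphs near the pole (`IsSmallBump.measure_zeroSet_inter_ball_le`), and of volume
of order `δ^(d+1) / τ` with boundary, by Fubini (`IsSmallBump.volume_sublevel_diff_le`). The choice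
of `δ` for which this area or volume is of order `1 / (fmin n)` gives the two rates.
-/

open Filter Topology
open scoped RealInnerProductSpace

noncomputable section

namespace ManifoldEstimation

/-! ### Coordinate inclusions and restrictions -/

/-- The linear map `ℝ^k → ℝ^D` that pads a vector with zeros. -/
def inclLinear (k D : ℕ) : Ambient k →ₗ[ℝ] Ambient D where
  toFun x := WithLp.toLp 2 fun i => if h : i.val < k then x ⟨i, h⟩ else 0
  map_add' x y := by
    ext i
    by_cases h : i.val < k <;> simp [h]
  map_smul' c x := by
    ext i
    by_cases h : i.val < k <;> simp [h]

/-- The linear map `ℝ^D → ℝ^k` that keeps the first `k` coordinates. -/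
def restrLinear {k D : ℕ} (h : k ≤ D) : Ambient D →ₗ[ℝ] Ambient k where
  toFun y := WithLp.toLp 2 fun j => y (Fin.castLE h j)
  map_add' x y := by ext i; simp
  map_smul' c x := by ext i; simp

theorem inclLinear_apply {k D : ℕ} (x : Ambient k) (i : Fin D) :
    inclLinear k D x i = if h : i.val < k then x ⟨i, h⟩ else 0 := rfl

theorem inner_incl_linear {k D : ℕ} (h : k ≤ D) (z : Ambient D) (x : Ambient k) :
    ⟪z, inclLinear k D x⟫ = ⟪restrLinear h z, x⟫ := by
  simp only [PiLp.inner_apply]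
  refine (Fintype.sum_of_injective (Fin.castLE h) (Fin.castLE_injective h) _ _ ?_ ?_).symm
  · intro i hi
    have : ¬ i.val < k := fun hlt => hi ⟨⟨i, hlt⟩, rfl⟩
    simp [inclLinear_apply, this]
  · intro i
    simp [inclLinear_apply, restrLinear]

/-- The isometric inclusion of `ℝ^k` into `ℝ^D` as `ℝ^k × {0}`. -/
def incl {k D : ℕ} (h : k ≤ D) : Ambient k →ₗᵢ[ℝ] Ambient D where
  toLinearMap := inclLinear k D
  norm_map' x := by
    have h1 := inner_incl_linear h (inclLinear k D x) x
    have h2 : restrLinear h (inclLinear k D x) = x := by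
      ext i; simp [restrLinear, inclLinear_apply]
    rw [h2, real_inner_self_eq_norm_sq, real_inner_self_eq_norm_sq] at h1
    exact (sq_eq_sq₀ (norm_nonneg _) (norm_nonneg _)).1 h1

/-- The restriction of a vector of `ℝ^D` to its first `k` coordinates. -/
def restr {k D : ℕ} (h : k ≤ D) : Ambient D →L[ℝ] Ambient k :=
  LinearMap.toContinuousLinearMap (restrLinear h)

section Submanifold

variable {k D : ℕ} (h : k ≤ D)

theorem incl_apply (x : Ambient k) (i : Fin D) :
    incl h x i = if h : i.val < k then x ⟨i, h⟩ else 0 := rfl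

theorem incl_apply_of_lt (x : Ambient k) (i : Fin D) (hi : i.val < k) :
    incl h x i = x ⟨i, hi⟩ := by simp [incl_apply, hi]

@[simp] theorem restr_apply (y : Ambient D) (j : Fin k) :
    restr h y j = y (Fin.castLE h j) := rfl

@[simp] theorem restr_incl (x : Ambient k) : restr h (incl h x) = x := by
  ext i; simp [incl_apply]

theorem inner_incl (z : Ambient D) (x : Ambient k) : ⟪z, incl h x⟫ = ⟪restr h z, x⟫ :=
  inner_incl_linear h z x

theorem norm_restr_le (y : Ambient D) : ‖restr h y‖ ≤ ‖y‖ := by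
  have h1 : ‖restr h y‖ * ‖restr h y‖ ≤ ‖y‖ * ‖restr h y‖ := by
    rw [← real_inner_self_eq_norm_mul_norm, ← inner_incl]
    simpa using real_inner_le_norm y (incl h (restr h y))
  rcases (norm_nonneg (restr h y)).eq_or_lt with h0 | h0
  · rw [← h0]; positivity
  · exact le_of_mul_le_mul_right h1 h0

theorem incl_mem_flat (x : Ambient k) : incl h x ∈ flat k D := fun i hi => by
  simp [incl_apply, not_lt.2 hi]

theorem incl_restr {y : Ambient D} (hy : y ∈ flat k D) : incl h (restr h y) = y := by
  ext i
  by_cases hi : i.val < k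
  · simp [incl_apply, hi]
  · simp [incl_apply, hi, hy i (not_lt.1 hi)]

theorem image_incl_eq (s : Set (Ambient k)) :
    incl h '' s = {y | y ∈ flat k D ∧ restr h y ∈ s} := by
  ext y
  constructor
  · rintro ⟨x, hx, rfl⟩
    exact ⟨incl_mem_flat h x, by simpa using hx⟩
  · rintro ⟨hy, hs⟩
    exact ⟨_, hs, incl_restr h hy⟩

theorem add_mem_flat_iff {p y : Ambient D} (hp : p ∈ flat k D) :
    y + p ∈ flat k D ↔ y ∈ flat k D := by
  refine forall₂_congr fun i hi => ?_
  simp [hp i hi]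

/-! ### Local models of level and sublevel sets -/

theorem mem_flat_iff_of_lt {m D : ℕ} (hmD : m < D) (y : Ambient D) :
    y ∈ flat m D ↔ y ∈ flat (m + 1) D ∧ y ⟨m, hmD⟩ = 0 := by
  constructor
  · exact fun hy => ⟨fun i hi => hy i (by omega), hy _ le_rfl⟩
  · rintro ⟨h1, h2⟩ i hi
    rcases hi.eq_or_lt with hi | hi
    · have : i = ⟨m, hmD⟩ := Fin.ext hi.symm
      rw [this, h2]
    · exact h1 i hi

theorem mem_halfFlat_iff_of_lt {m D : ℕ} (hmD : m < D) (y : Ambient D) :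
    y ∈ halfFlat (m + 1) D ↔ y ∈ flat (m + 1) D ∧ 0 ≤ y ⟨m, hmD⟩ := by
  refine and_congr_right fun _ => ⟨fun H => H _ rfl, fun H i hi => ?_⟩
  have : i = ⟨m, hmD⟩ := Fin.ext (by simpa using hi)
  rwa [this]

section Straighten

variable {m : ℕ} (hm : m + 1 ≤ D) (F : Ambient (m + 1) → ℝ) (p : Ambient (m + 1))
  (i₀ : Fin (m + 1))

/-- The coordinate change that straightens the level set of `F` through `p`: coordinates are
centred at `p`, the coordinates `i₀` and `m` are exchanged, and then coordinate `m` is replaced by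
`-F`. -/
def straighten (y : Ambient D) : Ambient D :=
  WithLp.toLp 2 fun j => if j = Fin.castLE hm (Fin.last m) then -F (restr hm y)
    else (y - incl hm p) (Equiv.swap (Fin.castLE hm i₀) (Fin.castLE hm (Fin.last m)) j)

/-- The derivative of `straighten` at `p`, where `A` is the derivative of `F`. -/
def straightenDeriv (A : Ambient (m + 1) →L[ℝ] ℝ) : Ambient D →ₗ[ℝ] Ambient D where
  toFun y := WithLp.toLp 2 fun j => if j = Fin.castLE hm (Fin.last m) then -A (restr hm y)
    else y (Equiv.swap (Fin.castLE hm i₀) (Fin.castLE hm (Fin.last m)) j)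
  map_add' x y := by
    ext j
    simp only [PiLp.add_apply]
    split_ifs
    · rw [map_add, map_add, neg_add]
    · rfl
  map_smul' c x := by
    ext j
    simp only [PiLp.smul_apply, RingHom.id_apply]
    split_ifs
    · rw [map_smul, map_smul, smul_neg]
    · rfl

theorem contDiff_straighten (hF : ContDiff ℝ 2 F) : ContDiff ℝ 2 (straighten hm F p i₀) := by
  refine contDiff_euclidean.2 fun j => ?_
  by_cases hj : j = Fin.castLE hm (Fin.last m)
  · simp only [straighten, hj, if_true]
    exact (hF.comp (restr hm).contDiff).neg
  · simp only [straighten, hj, if_false]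
    exact contDiff_euclidean.1 (contDiff_id.sub contDiff_const) _

theorem hasFDerivAt_straighten (hF : ContDiff ℝ 2 F) :
    HasFDerivAt (straighten hm F p i₀)
      (LinearMap.toContinuousLinearMap (straightenDeriv hm i₀ (fderiv ℝ F p))) (incl hm p) := by
  rw [← hasFDerivWithinAt_univ, hasFDerivWithinAt_euclidean]
  intro j
  rw [hasFDerivWithinAt_univ]
  by_cases hj : j = Fin.castLE hm (Fin.last m)
  · have h1 : HasFDerivAt F (fderiv ℝ F p) (restr hm (incl hm p)) := by
      rw [restr_incl]
      exact (hF.differentiable (by norm_num) p).hasFDerivAt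
    have h2 := (h1.comp (incl hm p) (restr hm).hasFDerivAt).neg
    refine (h2.congr_fderiv ?_).congr_of_eventuallyEq ?_
    · ext y; simp [straightenDeriv, hj]
    · exact .of_forall fun y => by simp [straighten, hj]
  · have h1 : HasFDerivAt (fun y : Ambient D => y - incl hm p)
        (ContinuousLinearMap.id ℝ (Ambient D)) (incl hm p) := (hasFDerivAt_id _).sub_const _
    have h2 := (EuclideanSpace.proj (𝕜 := ℝ) (Equiv.swap (Fin.castLE hm i₀)
      (Fin.castLE hm (Fin.last m)) j)).hasFDerivAt.comp (incl hm p) h1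
    refine (h2.congr_fderiv ?_).congr_of_eventuallyEq ?_
    · ext y; simp [straightenDeriv, hj]
    · exact .of_forall fun y => by simp [straighten, hj]

theorem straightenDeriv_injective {A : Ambient (m + 1) →L[ℝ] ℝ}
    (hA : A (EuclideanSpace.single i₀ 1) ≠ 0) :
    Function.Injective (straightenDeriv (D := D) hm i₀ A) := by
  rw [injective_iff_map_eq_zero]
  intro y hy
  set l := Fin.castLE hm (Fin.last m)
  set q := Fin.castLE hm i₀
  have h1 : ∀ i, i ≠ q → y i = 0 := by
    intro i hi
    have h2 := congrArg (fun v : Ambient D => v (Equiv.swap q l i)) hy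
    have h3 : Equiv.swap q l i ≠ l := by
      intro h4
      exact hi (by simpa using congrArg (Equiv.swap q l) h4)
    simpa [straightenDeriv, h3, q, l] using h2
  have h2 : A (restr hm y) = 0 := by
    have h2 := congrArg (fun v : Ambient D => v l) hy
    simpa [straightenDeriv, l] using h2
  have h3 : restr hm y = y q • EuclideanSpace.single i₀ 1 := by
    ext i
    by_cases hi : i = i₀
    · subst hi; simp [q]
    · have : Fin.castLE hm i ≠ q := fun h => hi (Fin.castLE_injective hm h)
      simp [hi, h1 _ this]
  have h4 : y q = 0 := by
    rw [h3, map_smul, smul_eq_mul] at h2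
    exact (mul_eq_zero.1 h2).resolve_right hA
  ext i
  by_cases hi : i = q
  · rw [hi, h4]; rfl
  · rw [h1 i hi]; rfl

end Straighten

/-- Around a regular point of its zero set, `F : ℝ^(m+1) → ℝ` becomes minus the last coordinate
in suitable `C²` coordinates of `ℝ^D`. -/
theorem exists_straightening {m : ℕ} (hm : m + 1 ≤ D) {F : Ambient (m + 1) → ℝ}
    (hF : ContDiff ℝ 2 F) {p : Ambient (m + 1)} (hp : F p = 0) (hdF : fderiv ℝ F p ≠ 0) :
    ∃ Ψ : OpenPartialHomeomorph (Ambient D) (Ambient D),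
      (0 : Ambient D) ∈ Ψ.source ∧ Ψ 0 = incl hm p ∧
      ContDiffOn ℝ 2 Ψ Ψ.source ∧ ContDiffOn ℝ 2 Ψ.symm Ψ.target ∧
      ∀ y ∈ Ψ.source, (Ψ y ∈ flat (m + 1) D ↔ y ∈ flat (m + 1) D) ∧
        F (restr hm (Ψ y)) = -y ⟨m, hm⟩ := by
  obtain ⟨i₀, hi₀⟩ : ∃ i₀, fderiv ℝ F p (EuclideanSpace.single i₀ 1) ≠ 0 := by
    by_contra! H
    refine hdF (ContinuousLinearMap.coe_injective ?_)
    refine (EuclideanSpace.basisFun (Fin (m + 1)) ℝ).toBasis.ext fun i => ?_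
    simpa using H i
  set G := straighten hm F p i₀ with hG
  -- A linear injection of a finite-dimensional space into itself is invertible.
  set T : Ambient D ≃L[ℝ] Ambient D := (LinearEquiv.ofInjectiveEndo _
    (straightenDeriv_injective (D := D) hm i₀ hi₀)).toContinuousLinearEquiv
  have hGc : ContDiff ℝ 2 G := contDiff_straighten hm F p i₀ hF
  have hGd : HasFDerivAt G (T : Ambient D →L[ℝ] Ambient D) (incl hm p) :=
    (hasFDerivAt_straighten hm F p i₀ hF).congr_fderiv (by ext y : 1; rfl)
  have hG0 : G (incl hm p) = 0 := by
    ext j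
    by_cases hj : j = Fin.castLE hm (Fin.last m) <;> simp [hG, straighten, hj, hp]
  set Φ := (hGc.contDiffAt (x := incl hm p)).toOpenPartialHomeomorph G hGd (by norm_num)
  have hΦ : ∀ y, Φ y = G y := fun y => rfl
  have hps : incl hm p ∈ Φ.source :=
    ContDiffAt.mem_toOpenPartialHomeomorph_source hGc.contDiffAt hGd (by norm_num)
  have h0t : (0 : Ambient D) ∈ Φ.target := by
    rw [← hG0, ← hΦ]; exact Φ.map_source hps
  have hs0 : Φ.symm 0 = incl hm p := by rw [← hG0, ← hΦ, Φ.left_inv hps]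
  have hcs : ContDiffAt ℝ 2 Φ.symm 0 := by
    refine Φ.contDiffAt_symm (f₀' := T) h0t ?_ ?_
    · rw [hs0]; exact hGd
    · exact hGc.contDiffAt
  -- The inverse chart is only known to be `C²` near `0`, so its source is shrunk.
  obtain ⟨U, hU, hUo, h0U⟩ := eventually_nhds_iff.1 (hcs.eventually (by decide))
  refine ⟨Φ.symm.restrOpen U hUo, ⟨h0t, h0U⟩, hs0, ?_, ?_, ?_⟩
  · intro y hy
    exact (hU y hy.2).contDiffWithinAt
  · exact hGc.contDiffOn
  · rintro y ⟨hy, -⟩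
    have hy' : G (Φ.symm y) = y := Φ.right_inv hy
    set x := Φ.symm y
    change (x ∈ _ ↔ _) ∧ F (restr hm x) = _
    constructor
    · rw [← hy']
      refine forall₂_congr fun i hi => ?_
      have h1 : i ≠ Fin.castLE hm (Fin.last m) := by
        rintro rfl; simp at hi
      have h2 : i ≠ Fin.castLE hm i₀ := by
        rintro rfl; simp at hi; omega
      have h3 : incl hm p i = 0 := incl_mem_flat hm p i hi
      simp [hG, straighten, h1, Equiv.swap_apply_of_ne_of_ne h2 h1, h3]
    · have : y ⟨m, hm⟩ = -F (restr hm x) := by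
        rw [← hy']
        have : (⟨m, hm⟩ : Fin D) = Fin.castLE hm (Fin.last m) := rfl
        rw [this]
        simp [hG, straighten]
      rw [this, neg_neg]

theorem isLocalModel_of_forall_mem_iff {N M : Set (Ambient D)} {p : Ambient D}
    {Ψ : OpenPartialHomeomorph (Ambient D) (Ambient D)}
    (h0 : (0 : Ambient D) ∈ Ψ.source) (hp : Ψ 0 = p) (h1 : ContDiffOn ℝ 2 Ψ Ψ.source)
    (h2 : ContDiffOn ℝ 2 Ψ.symm Ψ.target) (h3 : ∀ y ∈ Ψ.source, (Ψ y ∈ M ↔ y ∈ N)) :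
    IsLocalModel N M p Ψ := by
  refine ⟨h0, hp, h1, h2, ?_⟩
  ext x
  constructor
  · rintro ⟨y, ⟨hy, hyN⟩, rfl⟩
    exact ⟨(h3 y hy).2 hyN, Ψ.map_source hy⟩
  · rintro ⟨hxM, hx⟩
    refine ⟨Ψ.symm x, ⟨Ψ.map_target hx, ?_⟩, Ψ.right_inv hx⟩
    rw [← h3 _ (Ψ.map_target hx), Ψ.right_inv hx]
    exact hxM

theorem incl_mem_interiorPoints_zeroSet {m : ℕ} (hm : m + 1 ≤ D) {F : Ambient (m + 1) → ℝ}
    (hF : ContDiff ℝ 2 F) {p : Ambient (m + 1)} (hp : F p = 0) (hdF : fderiv ℝ F p ≠ 0) :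
    incl hm p ∈ interiorPoints m (incl hm '' {x | F x = 0}) := by
  obtain ⟨Ψ, h0, h1, h2, h3, h4⟩ := exists_straightening hm hF hp hdF
  refine ⟨⟨p, hp, rfl⟩, Ψ, isLocalModel_of_forall_mem_iff h0 h1 h2 h3 fun y hy => ?_⟩
  rw [image_incl_eq, mem_ofPred_eq, (h4 y hy).1, mem_ofPred_eq, (h4 y hy).2, neg_eq_zero,
    mem_flat_iff_of_lt hm]

theorem incl_mem_boundaryPoints_sublevel {m : ℕ} (hm : m + 1 ≤ D) {F : Ambient (m + 1) → ℝ}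
    (hF : ContDiff ℝ 2 F) {p : Ambient (m + 1)} (hp : F p = 0) (hdF : fderiv ℝ F p ≠ 0) :
    incl hm p ∈ boundaryPoints (m + 1) (incl hm '' {x | F x ≤ 0}) := by
  obtain ⟨Ψ, h0, h1, h2, h3, h4⟩ := exists_straightening hm hF hp hdF
  refine ⟨⟨p, hp.le, rfl⟩, Ψ, isLocalModel_of_forall_mem_iff h0 h1 h2 h3 fun y hy => ?_⟩
  rw [image_incl_eq, mem_ofPred_eq, (h4 y hy).1, mem_ofPred_eq, (h4 y hy).2, neg_nonpos,
    mem_halfFlat_iff_of_lt hm]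

theorem incl_mem_interiorPoints_sublevel {F : Ambient k → ℝ}
    (hF : Continuous F) {p : Ambient k} (hp : F p < 0) :
    incl h p ∈ interiorPoints k (incl h '' {x | F x ≤ 0}) := by
  have hc : Continuous fun y : Ambient D => F (restr h (y + incl h p)) := by fun_prop
  refine ⟨⟨p, hp.le, rfl⟩,
    (Homeomorph.addRight (incl h p)).toOpenPartialHomeomorph.restrOpen
      {y | F (restr h (y + incl h p)) < 0} (isOpen_lt hc continuous_const),
    isLocalModel_of_forall_mem_iff ?_ ?_ ?_ ?_ ?_⟩
  · simpa using hp
  · simp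
  · exact (contDiff_id.add contDiff_const : ContDiff ℝ 2 fun y : Ambient D => y + incl h p).contDiffOn
  · exact (contDiff_id.add contDiff_const :
      ContDiff ℝ 2 fun y : Ambient D => y + -incl h p).contDiffOn
  · intro y hy
    have hy' : F (restr h (y + incl h p)) < 0 := by simpa using hy
    rw [image_incl_eq]
    change (y + incl h p ∈ _ ∧ _) ↔ _
    rw [add_mem_flat_iff (incl_mem_flat h p)]
    exact ⟨fun H => H.1, fun H => ⟨H, hy'.le⟩⟩

/-! ### Interior and boundary points are disjoint -/

/-- A transition map from a flat chart to a half-flat chart would have an injective derivative, and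
it would map `ℝ^d` into the hyperplane `ℝ^(d-1)`, since the coordinate of index `d - 1` of
the transition map has a minimum at `0`. -/
theorem disjoint_interiorPoints_boundaryPoints {m : ℕ} (hm : m + 1 ≤ D) (M : Set (Ambient D)) :
    Disjoint (interiorPoints (m + 1) M) (boundaryPoints (m + 1) M) := by
  rw [Set.disjoint_left]
  rintro p ⟨-, Φ, hΦ0, hΦp, hΦ, hΦs, hΦM⟩ ⟨-, Ψ, hΨ0, hΨp, hΨ, hΨs, hΨM⟩
  have hpΦ : p ∈ Φ.target := hΦp ▸ Φ.map_source hΦ0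
  have hpΨ : p ∈ Ψ.target := hΨp ▸ Ψ.map_source hΨ0
  have hΦp' : Φ.symm p = 0 := by rw [← hΦp, Φ.left_inv hΦ0]
  have hΨp' : Ψ.symm p = 0 := by rw [← hΨp, Ψ.left_inv hΨ0]
  have d1 : DifferentiableAt ℝ Φ 0 :=
    (hΦ.contDiffAt (Φ.open_source.mem_nhds hΦ0)).differentiableAt (by norm_num)
  have d2 : DifferentiableAt ℝ Φ.symm p :=
    (hΦs.contDiffAt (Φ.open_target.mem_nhds hpΦ)).differentiableAt (by norm_num)
  have d3 : DifferentiableAt ℝ Ψ 0 :=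
    (hΨ.contDiffAt (Ψ.open_source.mem_nhds hΨ0)).differentiableAt (by norm_num)
  have d4 : DifferentiableAt ℝ Ψ.symm p :=
    (hΨs.contDiffAt (Ψ.open_target.mem_nhds hpΨ)).differentiableAt (by norm_num)
  set A := fderiv ℝ Φ 0
  set A' := fderiv ℝ Φ.symm p
  set B := fderiv ℝ Ψ.symm p
  set B' := fderiv ℝ Ψ 0
  have hA : ∀ v, A' (A v) = v := by
    have h1 : HasFDerivAt (fun y => Φ.symm (Φ y)) (A'.comp A) 0 := by
      refine HasFDerivAt.comp 0 ?_ d1.hasFDerivAt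
      rw [hΦp]; exact d2.hasFDerivAt
    have h2 : HasFDerivAt (fun y => Φ.symm (Φ y)) (ContinuousLinearMap.id ℝ _) 0 :=
      (hasFDerivAt_id _).congr_of_eventuallyEq
        (Filter.eventually_of_mem (Φ.open_source.mem_nhds hΦ0) fun y hy => Φ.left_inv hy)
    exact fun v => congrArg (fun L => L v) (h1.unique h2)
  have hB : ∀ v, B' (B v) = v := by
    have h1 : HasFDerivAt (fun y => Ψ (Ψ.symm y)) (B'.comp B) p := by
      refine HasFDerivAt.comp p ?_ d4.hasFDerivAt
      rw [hΨp']; exact d3.hasFDerivAt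
    have h2 : HasFDerivAt (fun y => Ψ (Ψ.symm y)) (ContinuousLinearMap.id ℝ _) p :=
      (hasFDerivAt_id _).congr_of_eventuallyEq
        (Filter.eventually_of_mem (Ψ.open_target.mem_nhds hpΨ) fun y hy => Ψ.right_inv hy)
    exact fun v => congrArg (fun L => L v) (h1.unique h2)
  have hT : ∀ v ∈ flat (m + 1) D, B (A v) ∈ flat m D := by
    intro v hv
    have hd : HasDerivAt (fun t : ℝ => Ψ.symm (Φ (t • v))) (B (A v)) 0 := by
      have h1 : HasDerivAt (fun t : ℝ => t • v) v 0 := by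
        simpa using (hasDerivAt_id (0 : ℝ)).smul_const v
      have h2 : HasFDerivAt Φ A ((0 : ℝ) • v) := by rw [zero_smul]; exact d1.hasFDerivAt
      have h3 : HasFDerivAt Ψ.symm B (Φ ((0 : ℝ) • v)) := by
        rw [zero_smul, hΦp]; exact d4.hasFDerivAt
      exact h3.comp_hasDerivAt 0 (h2.comp_hasDerivAt 0 h1)
    have hev : ∀ᶠ t : ℝ in 𝓝 0, Ψ.symm (Φ (t • v)) ∈ halfFlat (m + 1) D := by
      have c1 : ContinuousAt (fun t : ℝ => t • v) 0 := by fun_prop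
      have c2 : ContinuousAt (fun t : ℝ => Φ (t • v)) 0 := by
        refine ContinuousAt.comp (g := Φ) ?_ c1
        rw [zero_smul]; exact d1.continuousAt
      have e1 : ∀ᶠ t : ℝ in 𝓝 0, t • v ∈ Φ.source :=
        c1.eventually_mem (by rw [zero_smul]; exact Φ.open_source.mem_nhds hΦ0)
      have e2 : ∀ᶠ t : ℝ in 𝓝 0, Φ (t • v) ∈ Ψ.target :=
        c2.eventually_mem (by rw [zero_smul, hΦp]; exact Ψ.open_target.mem_nhds hpΨ)
      filter_upwards [e1, e2] with t h1 h2
      have h3 : Φ (t • v) ∈ M := by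
        have : Φ (t • v) ∈ M ∩ Φ.target := by
          rw [← hΦM]
          exact mem_image_of_mem _ ⟨h1, fun i hi => by simp [hv i hi]⟩
        exact this.1
      have h4 : Φ (t • v) ∈ Ψ '' (Ψ.source ∩ halfFlat (m + 1) D) := by
        rw [hΨM]; exact ⟨h3, h2⟩
      obtain ⟨y, ⟨hy, hyN⟩, hyx⟩ := h4
      rw [← hyx, Ψ.left_inv hy]
      exact hyN
    rw [mem_flat_iff_of_lt hm]
    constructor
    · intro i hi
      have h1 := (EuclideanSpace.proj (𝕜 := ℝ) i).hasFDerivAt.comp_hasDerivAt 0 hd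
      have h2 : HasDerivAt (fun t : ℝ => Ψ.symm (Φ (t • v)) i) 0 0 :=
        (hasDerivAt_const (0 : ℝ) (0 : ℝ)).congr_of_eventuallyEq
          (hev.mono fun t ht => ht.1 i hi)
      exact h1.unique h2
    · have h1 := (EuclideanSpace.proj (𝕜 := ℝ) (⟨m, hm⟩ : Fin D)).hasFDerivAt.comp_hasDerivAt 0 hd
      refine IsLocalMin.hasDerivAt_eq_zero ?_ h1
      refine hev.mono fun t ht => ?_
      change Ψ.symm (Φ ((0 : ℝ) • v)) ⟨m, hm⟩ ≤ Ψ.symm (Φ (t • v)) ⟨m, hm⟩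
      rw [zero_smul, hΦp, hΨp']
      exact ((mem_halfFlat_iff_of_lt hm _).1 ht).2
  let S : Ambient (m + 1) →ₗ[ℝ] Ambient m :=
    (restr (by omega : m ≤ D)).toLinearMap ∘ₗ B.toLinearMap ∘ₗ A.toLinearMap ∘ₗ
      (incl hm).toLinearMap
  have hS : Function.Injective S := by
    intro x y hxy
    have h1 : ∀ z : Ambient (m + 1), incl (by omega : m ≤ D) (S z) = B (A (incl hm z)) :=
      fun z => incl_restr _ (hT _ (incl_mem_flat hm z))
    have h2 : B (A (incl hm x)) = B (A (incl hm y)) := by rw [← h1, ← h1, hxy]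
    have h3 : A (incl hm x) = A (incl hm y) := by rw [← hB (A _), h2, hB]
    have h4 : incl hm x = incl hm y := by rw [← hA (incl hm x), h3, hA]
    exact (incl hm).injective h4
  have := LinearMap.finrank_le_finrank_of_injective hS
  simp at this

/-! ### Hausdorff measure -/

theorem euclideanHausdorffMeasure_image_le {X Y : Type*} [EMetricSpace X] [MeasurableSpace X]
    [BorelSpace X] [EMetricSpace Y] [MeasurableSpace Y] [BorelSpace Y] {K : NNReal} {f : X → Y}
    {s : Set X} (hf : LipschitzOnWith K f s) (d : ℕ) :
    (μHE[d] : Measure Y) (f '' s) ≤ (K : ℝ≥0∞) ^ d * (μHE[d] : Measure X) s := by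
  have h1 := hf.hausdorffMeasure_image_le (d := (d : ℝ)) (by positivity)
  rw [ENNReal.rpow_natCast] at h1
  simp only [Measure.euclideanHausdorffMeasure_def, Measure.smul_apply, ENNReal.smul_def,
    smul_eq_mul]
  calc _ ≤ _ := mul_le_mul_right h1 _
    _ = _ := by ring

theorem euclideanHausdorffMeasure_image_incl (s : Set (Ambient k)) :
    (μHE[k] : Measure (Ambient D)) (incl h '' s) = volume s := by
  rw [(incl h).isometry.euclideanHausdorffMeasure_image,
    EuclideanSpace.euclideanHausdorffMeasure_eq_volume]

/-- Charts are locally bi-Lipschitz, so the Hausdorff measure on a submanifold has full support. -/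
theorem IsSubmanifoldWithBoundary.measure_inter_pos {m : ℕ} (hm : m + 1 ≤ D)
    {M : Set (Ambient D)} (hM : IsSubmanifoldWithBoundary (m + 1) M) {p : Ambient D} (hp : p ∈ M)
    {U : Set (Ambient D)} (hU : U ∈ 𝓝 p) : 0 < (μHE[m + 1] : Measure (Ambient D)) (M ∩ U) := by
  obtain ⟨N, hN, Ψ, h0, hΨp, -, hΨs, hΨM⟩ : ∃ N, halfFlat (m + 1) D ⊆ N ∧
      ∃ Ψ, IsLocalModel N M p Ψ := by
    rcases hM.2 p hp with H | H
    · exact ⟨_, fun x hx => hx.1, H.2⟩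
    · exact ⟨_, subset_rfl, H.2⟩
  have hpt : p ∈ Ψ.target := hΨp ▸ Ψ.map_source h0
  obtain ⟨K, t, ht, hK⟩ := ((hΨs.contDiffAt (Ψ.open_target.mem_nhds hpt)).of_le
    (by norm_num : (1 : WithTop ℕ∞) ≤ 2)).exists_lipschitzOnWith
  have hW : {y | y ∈ Ψ.source ∧ Ψ y ∈ t ∩ U} ∈ 𝓝 (0 : Ambient D) := by
    refine Filter.inter_mem (Ψ.open_source.mem_nhds h0) ?_
    refine (Ψ.continuousAt h0).preimage_mem_nhds ?_
    rw [hΨp]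
    exact Filter.inter_mem ht hU
  obtain ⟨r, hr, hrW⟩ := Metric.mem_nhds_iff.1 hW
  set s : Set (Ambient (m + 1)) := Metric.ball 0 r ∩ {x | 0 < x (Fin.last m)} with hs
  have hso : IsOpen s := by
    refine Metric.isOpen_ball.inter (isOpen_lt continuous_const (by fun_prop))
  have hsne : s.Nonempty := by
    refine ⟨EuclideanSpace.single (Fin.last m) (r / 2), ?_, ?_⟩
    · simp [abs_of_pos hr, hr]
    · simp [hr]
  have hsub : incl hm '' s ⊆ Ψ.symm '' (M ∩ (t ∩ U)) := by
    rintro _ ⟨x, hx, rfl⟩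
    have hb : incl hm x ∈ Metric.ball (0 : Ambient D) r := by
      simpa using hx.1
    have h1 := hrW hb
    refine ⟨Ψ (incl hm x), ⟨?_, h1.2⟩, Ψ.left_inv h1.1⟩
    have : Ψ (incl hm x) ∈ M ∩ Ψ.target := by
      rw [← hΨM]
      refine mem_image_of_mem _ ⟨h1.1, hN ?_⟩
      rw [mem_halfFlat_iff_of_lt hm]
      refine ⟨incl_mem_flat hm x, ?_⟩
      rw [incl_apply_of_lt hm x _ (Nat.lt_succ_self m)]
      exact hx.2.le
    exact this.1
  have h1 : 0 < (μHE[m + 1] : Measure (Ambient D)) (Ψ.symm '' (M ∩ (t ∩ U))) := by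
    refine lt_of_lt_of_le ?_ (measure_mono hsub)
    rw [euclideanHausdorffMeasure_image_incl]
    exact hso.measure_pos _ hsne
  have h2 := euclideanHausdorffMeasure_image_le
    (hK.mono (inter_subset_right.trans inter_subset_left : M ∩ (t ∩ U) ⊆ t)) (m + 1)
  have h3 : 0 < (μHE[m + 1] : Measure (Ambient D)) (M ∩ (t ∩ U)) := by
    rw [pos_iff_ne_zero]
    intro h0
    rw [h0, mul_zero] at h2
    exact h1.not_ge h2
  exact h3.trans_le (measure_mono (inter_subset_inter_right _ inter_subset_right))

end Submanifold

/-! ### Reach of level sets and of convex sets -/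

/-- The reach of a regular level set is bounded below by the ratio of the size of the gradient to
the second-order variation of the defining function: at a point `x` nearest to `z`, the vector
`z - x` is normal by Lagrange's multiplier rule, and the second-order bound then keeps every other
point `y` of the level set farther from `z`. -/
theorem ofReal_le_reach_zeroSet {k D : ℕ} (h : k ≤ D) {F : Ambient k → ℝ} (hF : ContDiff ℝ 2 F)
    {L r : ℝ} (hL : 0 < L)
    (hFL : ∀ x y, F x = 0 → F y = 0 → |fderiv ℝ F x (y - x)| ≤ L * ‖y - x‖ ^ 2)
    (hr : ∀ x, F x = 0 → 2 * L * r ≤ ‖fderiv ℝ F x‖) (h0 : ∀ x, F x = 0 → fderiv ℝ F x ≠ 0) :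
    ENNReal.ofReal r ≤ reach (incl h '' {x | F x = 0}) := by
  refine le_iInf₂ fun z hz => ?_
  obtain ⟨-, ⟨x, hx, rfl⟩, -, ⟨y, hy, rfl⟩, hxy, hzx, hzy⟩ := hz
  set S := incl h '' {x | F x = 0} with hS
  have hxF : F x = 0 := hx
  have hyF : F y = 0 := hy
  have hne : S.Nonempty := ⟨_, mem_image_of_mem _ hx⟩
  have hinf : Metric.infEDist z S = ENNReal.ofReal (dist z (incl h x)) := by
    rw [hzx, Metric.infDist, ENNReal.ofReal_toReal (Metric.infEDist_ne_top hne)]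
  rw [hinf]
  refine ENNReal.ofReal_le_ofReal ?_
  set w := restr h z with hw
  have hdist : ∀ v : Ambient k, dist z (incl h v) ^ 2 = ‖z‖ ^ 2 - 2 * ⟪w, v⟫ + ‖v‖ ^ 2 := by
    intro v
    rw [dist_eq_norm, norm_sub_sq_real, inner_incl, LinearIsometry.norm_map]
  have hmin : IsLocalExtrOn (fun v : Ambient k => ‖v‖ ^ 2 - 2 * ⟪w, v⟫) {v | F v = F x} x := by
    refine Or.inl (IsMinOn.localize fun v hv => ?_)
    have hv' : F v = 0 := by rw [show F v = F x from hv, hxF]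
    have h1 : dist z (incl h x) ≤ dist z (incl h v) := by
      rw [hzx]; exact Metric.infDist_le_dist_of_mem (mem_image_of_mem _ hv')
    have h2 := pow_le_pow_left₀ dist_nonneg h1 2
    rw [hdist, hdist] at h2
    change ‖x‖ ^ 2 - 2 * ⟪w, x⟫ ≤ ‖v‖ ^ 2 - 2 * ⟪w, v⟫
    linarith
  have hφ : HasStrictFDerivAt (fun v : Ambient k => ‖v‖ ^ 2 - 2 * ⟪w, v⟫)
      ((2 : ℕ) • innerSL ℝ x - (2 : ℝ) • innerSL ℝ w) x :=
    (hasStrictFDerivAt_norm_sq x).fun_sub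
      (((innerSL ℝ w).hasStrictFDerivAt (x := x)).const_mul (2 : ℝ))
  have hFd : HasStrictFDerivAt F (fderiv ℝ F x) x :=
    hF.contDiffAt.hasStrictFDerivAt (by norm_num)
  obtain ⟨a, b, hab, hmul⟩ := hmin.exists_multipliers_of_hasStrictFDerivAt_1d hFd hφ
  -- The multiplier of the squared distance is nonzero because `0` is a regular value of `F`.
  have hb : b ≠ 0 := by
    rintro rfl
    have ha : a • fderiv ℝ F x = 0 := by simpa using hmul
    rcases smul_eq_zero.1 ha with ha | ha
    · exact hab (by rw [ha]; rfl)
    · exact h0 x hxF ha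
  obtain ⟨s, hs⟩ : ∃ s : ℝ, ∀ v, ⟪w - x, v⟫ = s * fderiv ℝ F x v := by
    refine ⟨a / (2 * b), fun v => ?_⟩
    have h1 := congrArg (fun A : Ambient k →L[ℝ] ℝ => A v) hmul
    simp only [add_apply, smul_apply, smul_eq_mul, sub_apply, innerSL_apply_apply, zero_apply,
      nsmul_eq_mul, Nat.cast_ofNat] at h1
    rw [inner_sub_left]
    field_simp
    linarith
  have hwx : ‖w - x‖ ≤ dist z (incl h x) := by
    have h1 : w - x = restr h (z - incl h x) := by rw [map_sub, restr_incl]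
    rw [h1, dist_eq_norm]
    exact norm_restr_le h _
  have hsn : |s| * ‖fderiv ℝ F x‖ ≤ ‖w - x‖ := by
    rw [← Real.norm_eq_abs, ← norm_smul]
    refine ContinuousLinearMap.opNorm_le_bound _ (norm_nonneg _) fun v => ?_
    rw [smul_apply, smul_eq_mul, ← hs v, Real.norm_eq_abs]
    exact abs_real_inner_le_norm _ _
  have hyx : y ≠ x := fun e => hxy (by rw [e])
  have hpos : 0 < ‖y - x‖ ^ 2 := by
    have := norm_pos_iff.2 (sub_ne_zero.2 hyx)
    positivity
  -- Expansion of the equality of the distances from `z` to `x` and to `y`.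
  have heq : ‖y - x‖ ^ 2 = 2 * (s * fderiv ℝ F x (y - x)) := by
    have h1 : dist z (incl h x) ^ 2 = dist z (incl h y) ^ 2 := by rw [hzx, hzy]
    rw [hdist, hdist] at h1
    rw [← hs, inner_sub_left, inner_sub_right, inner_sub_right, norm_sub_sq_real,
      real_inner_self_eq_norm_sq, real_inner_comm x y]
    linarith
  have hle : ‖y - x‖ ^ 2 ≤ 2 * (|s| * (L * ‖y - x‖ ^ 2)) := by
    calc ‖y - x‖ ^ 2 = 2 * (s * fderiv ℝ F x (y - x)) := heq
      _ ≤ 2 * |s * fderiv ℝ F x (y - x)| := by gcongr; exact le_abs_self _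
      _ ≤ _ := by rw [abs_mul]; gcongr; exact hFL x y hxF hyF
  have h1 : 1 ≤ 2 * |s| * L := by
    by_contra! H
    nlinarith
  have h2 : 2 * L * r ≤ 2 * L * dist z (incl h x) := by
    calc 2 * L * r ≤ ‖fderiv ℝ F x‖ := hr x hxF
      _ ≤ 2 * |s| * L * ‖fderiv ℝ F x‖ := le_mul_of_one_le_left (norm_nonneg _) h1
      _ = 2 * L * (|s| * ‖fderiv ℝ F x‖) := by ring
      _ ≤ 2 * L * dist z (incl h x) := by gcongr; exact hsn.trans hwx
  exact le_of_mul_le_mul_left h2 (by positivity)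

theorem reach_eq_top_of_convex {D : ℕ} {S : Set (Ambient D)} (hS : Convex ℝ S) : reach S = ⊤ := by
  have h1 : medialAxis S = ∅ := by
    rw [eq_empty_iff_forall_notMem]
    rintro z ⟨x, hx, y, hy, hxy, hzx, hzy⟩
    have hmid : (1 / 2 : ℝ) • x + (1 / 2 : ℝ) • y ∈ S :=
      hS hx hy (by norm_num) (by norm_num) (by norm_num)
    have h1 := Metric.infDist_le_dist_of_mem (x := z) hmid
    have h2 : dist z ((1 / 2 : ℝ) • x + (1 / 2 : ℝ) • y) ^ 2
        = (dist z x ^ 2 + dist z y ^ 2) / 2 - ‖x - y‖ ^ 2 / 4 := by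
      have e1 : z - ((1 / 2 : ℝ) • x + (1 / 2 : ℝ) • y) = (1 / 2 : ℝ) • ((z - x) + (z - y)) := by
        module
      have e2 : x - y = (z - y) - (z - x) := by abel
      rw [dist_eq_norm, dist_eq_norm, dist_eq_norm, e1, e2]
      generalize z - x = u
      generalize z - y = v
      rw [norm_smul, mul_pow, norm_add_sq_real, norm_sub_sq_real, real_inner_comm u v]
      norm_num
      ring
    have h3 : 0 < ‖x - y‖ := norm_pos_iff.2 (sub_ne_zero.2 hxy)
    have h4 := pow_le_pow_left₀ Metric.infDist_nonneg h1 2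
    rw [h2, hzx, hzy] at h4
    nlinarith
  simp [reach, h1]

theorem reach_empty {D : ℕ} : reach (∅ : Set (Ambient D)) = ⊤ :=
  reach_eq_top_of_convex convex_empty

/-! ### Two-point lower bound for the minimax risk -/

theorem measure_pi_mono {ι : Type*} [Fintype ι] {α : ι → Type*} [∀ i, MeasurableSpace (α i)]
    {μ ν : ∀ i, Measure (α i)} [∀ i, SigmaFinite (μ i)] (hμν : ∀ i, μ i ≤ ν i) :
    Measure.pi μ ≤ Measure.pi ν := by
  have h1 : (Measure.pi μ).toOuterMeasure ≤ OuterMeasure.pi fun i => (ν i).toOuterMeasure := by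
    rw [OuterMeasure.le_pi]
    intro s _
    exact (Measure.pi_pi μ s).le.trans (Finset.prod_le_prod' fun i _ => hμν i (s i))
  refine Measure.le_iff.2 fun s hs => ?_
  rw [Measure.pi_def (μ := ν), toMeasure_apply _ _ hs]
  exact h1 s

/-- Le Cam's two-point bound: a common minorant of mass at least `1 / 2` of the laws of the samples
under two distributions of the model forces a risk of at least a quarter of the distance of their
supports. -/
theorem hausdorffEDist_div_four_le_minimaxRisk {D n : ℕ} {Model : Set (Measure (Ambient D))}
    {P₀ P₁ : Measure (Ambient D)} (h₀ : P₀ ∈ Model) (h₁ : P₁ ∈ Model)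
    {ν : Measure (Fin n → Ambient D)} (hν₀ : ν ≤ sampleLaw P₀ n) (hν₁ : ν ≤ sampleLaw P₁ n)
    (hν : 2⁻¹ ≤ ν univ) :
    Metric.hausdorffEDist P₀.support P₁.support / 4 ≤ minimaxRisk Model n := by
  refine le_iInf₂ fun Mhat hM => ?_
  set s := ⨆ P ∈ Model, risk P n Mhat
  have ha : ∫⁻ x, Metric.hausdorffEDist P₀.support (Mhat x) ∂ν ≤ s :=
    (lintegral_mono' hν₀ le_rfl).trans (le_iSup₂ (f := fun P _ => risk P n Mhat) P₀ h₀)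
  have hb : ∫⁻ x, Metric.hausdorffEDist P₁.support (Mhat x) ∂ν ≤ s :=
    (lintegral_mono' hν₁ le_rfl).trans (le_iSup₂ (f := fun P _ => risk P n Mhat) P₁ h₁)
  have hmeas : AEMeasurable (fun x => Metric.hausdorffEDist P₀.support (Mhat x)) ν :=
    (hM P₀ h₀).mono_measure hν₀
  set H := Metric.hausdorffEDist P₀.support P₁.support
  have h2 : H * 2⁻¹ ≤ 2 * s := by
    calc H * 2⁻¹ ≤ H * ν univ := by gcongr
      _ = ∫⁻ _, H ∂ν := (lintegral_const _).symm
      _ ≤ ∫⁻ x, (Metric.hausdorffEDist P₀.support (Mhat x) +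
            Metric.hausdorffEDist P₁.support (Mhat x)) ∂ν := by
          refine lintegral_mono fun x => ?_
          rw [Metric.hausdorffEDist_comm (s := P₁.support)]
          exact Metric.hausdorffEDist_triangle
      _ = _ := lintegral_add_left' hmeas _
      _ ≤ s + s := add_le_add ha hb
      _ = 2 * s := (two_mul s).symm
  have h4 : H / 4 = 2⁻¹ * (H * 2⁻¹) := by
    have : (4 : ℝ≥0∞)⁻¹ = 2⁻¹ * 2⁻¹ := by
      rw [← ENNReal.mul_inv (by simp) (by simp)]; norm_num
    rw [div_eq_mul_inv, this]; ring
  rw [h4]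
  calc 2⁻¹ * (H * 2⁻¹) ≤ 2⁻¹ * (2 * s) := by gcongr
    _ = s := by rw [← mul_assoc, ENNReal.inv_mul_cancel (by simp) (by simp), one_mul]

open Classical in
/-- The measure on `M` whose density with respect to the `d`-dimensional Hausdorff measure is `f`
on `U` and `g` off `U`. -/
def twoLevel (d : ℕ) {D : ℕ} (M U : Set (Ambient D)) (f g : ℝ) : Measure (Ambient D) :=
  ((Measure.euclideanHausdorffMeasure d).restrict M).withDensity
    fun x => ENNReal.ofReal (if x ∈ U then f else g)

section TwoLevel

variable {d D : ℕ} {M U : Set (Ambient D)} {f g : ℝ}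

theorem twoLevel_apply (hU : MeasurableSet U) {s : Set (Ambient D)} (hs : MeasurableSet s) :
    twoLevel d M U f g s = ENNReal.ofReal f * (μHE[d] : Measure (Ambient D)) (s ∩ U ∩ M) +
      ENNReal.ofReal g * (μHE[d] : Measure (Ambient D)) (s \ U ∩ M) := by
  classical
  rw [twoLevel, withDensity_apply _ hs, ← lintegral_inter_add_sdiff _ s hU,
    setLIntegral_congr_fun (g := fun _ => ENNReal.ofReal f) (hs.inter hU)
      (fun x hx => by simp [hx.2]),
    setLIntegral_congr_fun (g := fun _ => ENNReal.ofReal g) (hs.diff hU)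
      (fun x hx => by simp [hx.2]),
    setLIntegral_const, setLIntegral_const, Measure.restrict_apply (hs.inter hU),
    Measure.restrict_apply (hs.diff hU)]

theorem support_twoLevel (hU : MeasurableSet U) (hM : IsClosed M) (hf : 0 < f) (hfg : f ≤ g)
    (hpos : ∀ p ∈ M, ∀ V ∈ 𝓝 p, 0 < (μHE[d] : Measure (Ambient D)) (M ∩ V)) :
    (twoLevel d M U f g).support = M := by
  refine subset_antisymm (Measure.support_subset_of_isClosed hM ?_) fun p hp => ?_
  · rw [mem_ae_iff, twoLevel_apply hU hM.measurableSet.compl]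
    have e1 : Mᶜ ∩ U ∩ M = ∅ := by ext; simp; tauto
    have e2 : Mᶜ \ U ∩ M = ∅ := by ext; simp; tauto
    simp [e1, e2]
  · rw [Measure.mem_support_iff_forall]
    intro V hV
    obtain ⟨W, hWV, hW, hpW⟩ := mem_nhds_iff.1 hV
    refine lt_of_lt_of_le ?_ (measure_mono hWV)
    rw [twoLevel_apply hU hW.measurableSet]
    have h1 := hpos p hp W (hW.mem_nhds hpW)
    have h2 : (μHE[d] : Measure (Ambient D)) (M ∩ W) ≤
        (μHE[d] : Measure (Ambient D)) (W ∩ U ∩ M) + (μHE[d] : Measure (Ambient D)) (W \ U ∩ M) := by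
      refine (measure_mono ?_).trans (measure_union_le _ _)
      intro x hx
      by_cases hxU : x ∈ U
      · exact Or.inl ⟨⟨hx.2, hxU⟩, hx.1⟩
      · exact Or.inr ⟨⟨hx.2, hxU⟩, hx.1⟩
    have h3 : ENNReal.ofReal f * (μHE[d] : Measure (Ambient D)) (M ∩ W) ≤
        ENNReal.ofReal f * (μHE[d] : Measure (Ambient D)) (W ∩ U ∩ M) +
          ENNReal.ofReal g * (μHE[d] : Measure (Ambient D)) (W \ U ∩ M) := by
      refine (mul_le_mul_right h2 _).trans ?_
      rw [mul_add]
      gcongr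
    refine lt_of_lt_of_le ?_ h3
    exact ENNReal.mul_pos (by simpa using hf) h1.ne'

theorem twoLevel_mem_statisticalModel {τ τb : ℝ≥0∞} {fmin fmax a b : ℝ}
    (hMg : M ∈ geometricModel d D τ τb)
    (hpos : ∀ p ∈ M, ∀ V ∈ 𝓝 p, 0 < (μHE[d] : Measure (Ambient D)) (M ∩ V))
    (hU : MeasurableSet U) (ha : 0 < a) (hb : 0 ≤ b)
    (hMa : (μHE[d] : Measure (Ambient D)) (M \ U) = ENNReal.ofReal a)
    (hMb : (μHE[d] : Measure (Ambient D)) (M ∩ U) = ENNReal.ofReal b)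
    (hf : 0 < fmin) (hff : fmin ≤ fmax) (h1 : fmin * (a + b) ≤ 1) (h2 : 1 ≤ fmax * a) :
    twoLevel d M U fmin ((1 - fmin * b) / a) ∈ statisticalModel d D τ τb fmin fmax ∧
      (twoLevel d M U fmin ((1 - fmin * b) / a)).support = M := by
  classical
  set g := (1 - fmin * b) / a
  have hg1 : fmin ≤ g := by rw [le_div_iff₀ ha]; linarith
  have hg2 : g ≤ fmax := by
    rw [div_le_iff₀ ha]
    have : 0 ≤ fmin * b := by positivity
    linarith
  have hsupp := support_twoLevel hU hMg.1.isClosed hf hg1 hpos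
  refine ⟨⟨⟨?_⟩, by rwa [hsupp], fun x => if x ∈ U then fmin else g,
    Measurable.ite hU measurable_const measurable_const, fun x _ => ?_, ?_⟩, hsupp⟩
  · rw [twoLevel_apply hU MeasurableSet.univ, univ_inter, inter_comm, hMb, ← compl_eq_univ_sdiff,
      inter_comm, ← sdiff_eq, hMa, ← ENNReal.ofReal_mul hf.le,
      ← ENNReal.ofReal_mul (hf.le.trans hg1), ← ENNReal.ofReal_add (by positivity)
        (mul_nonneg (hf.le.trans hg1) ha.le), div_mul_cancel₀ _ ha.ne']
    simp
  · dsimp only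
    split_ifs
    · exact ⟨le_rfl, hff⟩
    · exact ⟨hg1, hg2⟩
  · rw [hsupp]; rfl

/-- Two members of the geometric model that coincide off `U`, and of which only a mass `1 / (2 n)`
at density `fmin` lies in `U`, cannot be told apart from `n` observations. -/
theorem hausdorffEDist_div_four_le_of_diff_eq {Model : Set (Measure (Ambient D))}
    {τ τb : ℝ≥0∞} {fmin fmax a : ℝ} {n : ℕ} (hn : 1 ≤ n) {M : Fin 2 → Set (Ambient D)}
    {b : Fin 2 → ℝ}
    (hModel : ∀ P ∈ statisticalModel d D τ τb fmin fmax, ∀ i, P.support = M i → P ∈ Model)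
    (hMg : ∀ i, M i ∈ geometricModel d D τ τb)
    (hpos : ∀ i, ∀ p ∈ M i, ∀ V ∈ 𝓝 p, 0 < (μHE[d] : Measure (Ambient D)) (M i ∩ V))
    (hU : MeasurableSet U) (hM : M 0 \ U = M 1 \ U) (ha : 0 < a) (hb : ∀ i, 0 ≤ b i)
    (hMa : (μHE[d] : Measure (Ambient D)) (M 0 \ U) = ENNReal.ofReal a)
    (hMb : ∀ i, (μHE[d] : Measure (Ambient D)) (M i ∩ U) = ENNReal.ofReal (b i))
    (hf : 0 < fmin) (hff : fmin ≤ fmax) (h1 : ∀ i, fmin * (a + b i) ≤ 1) (h2 : 1 ≤ fmax * a)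
    (hbn : ∀ i, fmin * b i ≤ 1 / (2 * n)) :
    Metric.hausdorffEDist (M 0) (M 1) / 4 ≤ minimaxRisk Model n := by
  have hMa' : ∀ i, (μHE[d] : Measure (Ambient D)) (M i \ U) = ENNReal.ofReal a := by
    intro i
    fin_cases i
    · exact hMa
    · exact hM ▸ hMa
  have hMi : ∀ i, M i \ U = M 0 \ U := by
    intro i
    fin_cases i
    · rfl
    · exact hM.symm
  have key := fun i => twoLevel_mem_statisticalModel (hMg i) (hpos i) hU ha (hb i) (hMa' i)
    (hMb i) hf hff (h1 i) h2
  have hn' : (1 : ℝ) ≤ n := by exact_mod_cast hn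
  have hq : 0 ≤ 1 - 1 / (2 * (n : ℝ)) := by
    rw [sub_nonneg, div_le_one (by positivity)]; linarith
  set q := (1 - 1 / (2 * (n : ℝ))) / a
  -- `q` is below the density off `U` of both distributions, so `Q` is a common minorant.
  set Q : Measure (Ambient D) :=
    ENNReal.ofReal q • (Measure.euclideanHausdorffMeasure d).restrict (M 0 \ U) with hQ
  have hQuniv : Q univ = ENNReal.ofReal (1 - 1 / (2 * (n : ℝ))) := by
    rw [hQ, Measure.smul_apply, Measure.restrict_apply_univ, hMa, smul_eq_mul,
      ← ENNReal.ofReal_mul (by positivity), div_mul_cancel₀ _ ha.ne']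
  have : IsFiniteMeasure Q := ⟨by rw [hQuniv]; exact ENNReal.ofReal_lt_top⟩
  have hQP : ∀ i, Q ≤ twoLevel d (M i) U fmin ((1 - fmin * b i) / a) := by
    intro i
    refine Measure.le_iff.2 fun s hs => ?_
    rw [twoLevel_apply hU hs, hQ, Measure.smul_apply, Measure.restrict_apply hs, smul_eq_mul,
      ← hMi i]
    have e : s ∩ (M i \ U) = s \ U ∩ M i := by ext; simp; tauto
    rw [e]
    refine le_add_left (mul_le_mul_left (ENNReal.ofReal_le_ofReal ?_) _)
    refine div_le_div_of_nonneg_right ?_ ha.le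
    linarith [hbn i]
  have hbound := hausdorffEDist_div_four_le_minimaxRisk (n := n)
    (hModel _ (key 0).1 0 (key 0).2) (hModel _ (key 1).1 1 (key 1).2)
    (ν := Measure.pi fun _ => Q) (measure_pi_mono fun _ => hQP 0)
    (measure_pi_mono fun _ => hQP 1) ?_
  · rwa [(key 0).2, (key 1).2] at hbound
  · rw [Measure.pi_univ, Finset.prod_const, Finset.card_univ, Fintype.card_fin, hQuniv,
      ← ENNReal.ofReal_pow hq]
    have h3 : (2 : ℝ)⁻¹ ≤ (1 - 1 / (2 * (n : ℝ))) ^ n := by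
      have h4 := one_add_mul_le_pow (a := -(1 / (2 * (n : ℝ)))) (by linarith) n
      have h5 : 1 + (n : ℝ) * -(1 / (2 * (n : ℝ))) = 2⁻¹ := by field_simp; norm_num
      rw [h5] at h4
      simpa [sub_eq_add_neg] using h4
    calc (2 : ℝ≥0∞)⁻¹ = ENNReal.ofReal 2⁻¹ := by
          rw [ENNReal.ofReal_inv_of_pos (by norm_num)]; simp
      _ ≤ _ := ENNReal.ofReal_le_ofReal h3

end TwoLevel

/-! ### Small bumps -/

/-- `ψ` is a `C²` perturbation of width `δ` around `p` whose size, slope and second-order variation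
are those of a bump of height of order `δ²`. The zero function is one. -/
structure IsSmallBump {E : Type*} [NormedAddCommGroup E] [NormedSpace ℝ E]
    (p : E) (δ : ℝ) (ψ : E → ℝ) : Prop where
  contDiff : ContDiff ℝ 2 ψ
  nonneg : ∀ x, 0 ≤ ψ x
  le : ∀ x, ψ x ≤ δ ^ 2 / 4
  eq_zero : ∀ x, δ ≤ dist x p → ψ x = 0
  lipschitz : ∀ x y, |ψ x - ψ y| ≤ δ / 4 * ‖x - y‖
  taylor : ∀ x y, |ψ y - ψ x - fderiv ℝ ψ x (y - x)| ≤ 1 / 4 * ‖y - x‖ ^ 2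

theorem isSmallBump_zero {E : Type*} [NormedAddCommGroup E] [NormedSpace ℝ E] (p : E) {δ : ℝ}
    (hδ : 0 ≤ δ) : IsSmallBump p δ (fun _ => 0) where
  contDiff := contDiff_const
  nonneg _ := le_rfl
  le _ := by positivity
  eq_zero _ _ := rfl
  lipschitz x y := by simp; positivity
  taylor x y := by simp

theorem abs_sub_sub_fderiv_le {E : Type*} [NormedAddCommGroup E] [NormedSpace ℝ E] {φ : E → ℝ}
    (hφ : Differentiable ℝ φ) {C : NNReal} (hC : LipschitzWith C (fderiv ℝ φ)) (x y : E) :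
    |φ y - φ x - fderiv ℝ φ x (y - x)| ≤ C * ‖y - x‖ ^ 2 := by
  have h1 := Convex.norm_image_sub_le_of_norm_fderiv_le' (𝕜 := ℝ) (f := φ) (C := C * ‖y - x‖)
    (s := Metric.closedBall x ‖y - x‖) (φ := fderiv ℝ φ x) (fun z _ => hφ z)
    (fun z hz => ?_) (convex_closedBall _ _) (Metric.mem_closedBall_self (norm_nonneg _))
    (y := y) (by simp [dist_eq_norm])
  · rw [Real.norm_eq_abs] at h1
    calc _ ≤ _ := h1
      _ = _ := by ring
  · rw [← dist_eq_norm]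
    exact (hC.dist_le_mul z x).trans (mul_le_mul_of_nonneg_left hz C.2)

/-- A fixed smooth bump function, rescaled in width by `δ` and in height by a multiple of `δ²`. -/
theorem exists_isSmallBump (E : Type*) [NormedAddCommGroup E] [InnerProductSpace ℝ E]
    [FiniteDimensional ℝ E] :
    ∃ a : ℝ, 0 < a ∧ ∀ (p : E) (δ : ℝ), 0 < δ →
      ∃ ψ, IsSmallBump p δ ψ ∧ ∀ x, dist x p ≤ δ / 2 → ψ x = a * δ ^ 2 := by
  let φ : ContDiffBump (0 : E) := ⟨1 / 2, 1, by norm_num, by norm_num⟩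
  have hφ : ContDiff ℝ 2 φ := φ.contDiff
  have hd : Differentiable ℝ φ := hφ.differentiable (by norm_num)
  obtain ⟨C₁, hC₁⟩ := hφ.lipschitzWith_of_hasCompactSupport φ.hasCompactSupport (by norm_num)
  obtain ⟨C₂, hC₂⟩ := (hφ.fderiv_right (m := 1) (by norm_num)).lipschitzWith_of_hasCompactSupport
    (φ.hasCompactSupport.fderiv ℝ) (by norm_num)
  set C : ℝ := C₁ + C₂ + 1 with hC
  have h1 := C₁.2
  have h2 := C₂.2
  have hCpos : 0 < C := by positivity
  have hCone : 1 ≤ C := by rw [hC]; simpa using add_nonneg h1 h2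
  refine ⟨1 / (4 * C), by positivity, fun p δ hδ => ?_⟩
  -- The factor `1 / (4 C)` reduces the slope and the second-order variation to at most `1 / 4`.
  set b := 1 / (4 * C) * δ ^ 2 with hb
  have hbpos : 0 < b := by positivity
  have hbδ : b ≤ δ ^ 2 / 4 := by
    rw [hb, one_div, inv_mul_le_iff₀ (by positivity)]
    nlinarith [sq_nonneg δ]
  have hb1 : b * C₁ ≤ δ ^ 2 / 4 := by
    rw [hb, one_div, mul_assoc, inv_mul_le_iff₀ (by positivity)]
    nlinarith [sq_nonneg δ]
  have hb2 : b * C₂ ≤ δ ^ 2 / 4 := by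
    rw [hb, one_div, mul_assoc, inv_mul_le_iff₀ (by positivity)]
    nlinarith [sq_nonneg δ]
  have hlin : ∀ x y : E, δ⁻¹ • (y - p) - δ⁻¹ • (x - p) = δ⁻¹ • (y - x) := fun x y => by module
  have hnorm : ∀ x y : E, ‖δ⁻¹ • (y - x)‖ = δ⁻¹ * ‖y - x‖ := fun x y => by
    rw [norm_smul, Real.norm_of_nonneg (by positivity)]
  have hfd : ∀ x v : E, fderiv ℝ (fun x => b * φ (δ⁻¹ • (x - p))) x v
      = b * fderiv ℝ φ (δ⁻¹ • (x - p)) (δ⁻¹ • v) := by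
    intro x v
    have e1 : HasFDerivAt (fun x : E => δ⁻¹ • (x - p)) (δ⁻¹ • ContinuousLinearMap.id ℝ E) x :=
      ((hasFDerivAt_id x).sub_const p).const_smul δ⁻¹
    have e2 := ((hd (δ⁻¹ • (x - p))).hasFDerivAt.comp x e1).const_mul b
    have e3 : fderiv ℝ (fun x => b * φ (δ⁻¹ • (x - p))) x = _ := e2.fderiv
    rw [e3]
    simp
  refine ⟨fun x => b * φ (δ⁻¹ • (x - p)), ⟨?_, fun x => ?_, fun x => ?_, fun x hx => ?_,
    fun x y => ?_, fun x y => ?_⟩, fun x hx => ?_⟩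
  · exact contDiff_const.mul (hφ.comp ((contDiff_id.sub contDiff_const).const_smul δ⁻¹))
  · exact mul_nonneg hbpos.le φ.nonneg
  · exact (mul_le_of_le_one_right hbpos.le φ.le_one).trans hbδ
  · rw [φ.zero_of_le_dist, mul_zero]
    rw [dist_zero_right, hnorm p x, ← dist_eq_norm]
    change (1 : ℝ) ≤ _
    rw [← div_eq_inv_mul, one_le_div hδ]
    exact hx
  · have e := hC₁.dist_le_mul (δ⁻¹ • (x - p)) (δ⁻¹ • (y - p))
    rw [dist_eq_norm, dist_eq_norm, hlin, hnorm, Real.norm_eq_abs] at e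
    rw [← mul_sub, abs_mul, abs_of_pos hbpos]
    calc b * _ ≤ b * (C₁ * (δ⁻¹ * ‖x - y‖)) := by gcongr
      _ = b * C₁ * (δ⁻¹ * ‖x - y‖) := by ring
      _ ≤ δ ^ 2 / 4 * (δ⁻¹ * ‖x - y‖) := by gcongr
      _ = δ / 4 * ‖x - y‖ := by field_simp
  · have e := abs_sub_sub_fderiv_le hd hC₂ (δ⁻¹ • (x - p)) (δ⁻¹ • (y - p))
    rw [hlin, hnorm] at e
    rw [hfd, ← mul_sub, ← mul_sub, abs_mul, abs_of_pos hbpos]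
    calc b * _ ≤ b * (C₂ * (δ⁻¹ * ‖y - x‖) ^ 2) := by gcongr
      _ = b * C₂ * (δ⁻¹ * ‖y - x‖) ^ 2 := by ring
      _ ≤ δ ^ 2 / 4 * (δ⁻¹ * ‖y - x‖) ^ 2 := by gcongr
      _ = 1 / 4 * ‖y - x‖ ^ 2 := by field_simp
  · dsimp only
    rw [φ.one_of_mem_closedBall, mul_one]
    rw [mem_closedBall_zero_iff, hnorm p x, ← dist_eq_norm]
    change _ ≤ (1 / 2 : ℝ)
    rw [← div_eq_inv_mul, div_le_iff₀ hδ]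
    linarith

/-! ### Perturbed balls and spheres -/

/-- The function whose sublevel set at `0` is the ball of radius `R` enlarged by `ψ`. -/
def profile {E : Type*} [NormedAddCommGroup E] (R : ℝ) (ψ : E → ℝ) (x : E) : ℝ :=
  ‖x‖ ^ 2 - R ^ 2 - ψ x

section Profile

variable {E : Type*} [NormedAddCommGroup E] [InnerProductSpace ℝ E] {R δ : ℝ} {p : E} {ψ : E → ℝ}

theorem IsSmallBump.contDiff_profile (hψ : IsSmallBump p δ ψ) : ContDiff ℝ 2 (profile R ψ) :=
  ((contDiff_norm_sq ℝ).sub contDiff_const).sub hψ.contDiff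

theorem IsSmallBump.fderiv_profile (hψ : IsSmallBump p δ ψ) (x v : E) :
    fderiv ℝ (profile R ψ) x v = 2 * ⟪x, v⟫ - fderiv ℝ ψ x v := by
  have h1 : HasFDerivAt (profile R ψ) ((2 : ℕ) • innerSL ℝ x - fderiv ℝ ψ x) x :=
    ((hasStrictFDerivAt_norm_sq x).hasFDerivAt.sub_const (R ^ 2)).fun_sub
      (hψ.contDiff.differentiable (by norm_num) x).hasFDerivAt
  rw [h1.fderiv]
  simp

theorem IsSmallBump.profile_sub (hψ : IsSmallBump p δ ψ) (x y : E) :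
    profile R ψ y - profile R ψ x - fderiv ℝ (profile R ψ) x (y - x) =
      ‖y - x‖ ^ 2 - (ψ y - ψ x - fderiv ℝ ψ x (y - x)) := by
  rw [hψ.fderiv_profile, profile, profile, norm_sub_sq_real, inner_sub_right,
    real_inner_self_eq_norm_sq, real_inner_comm x y]
  ring

theorem IsSmallBump.profile_taylor_le (hψ : IsSmallBump p δ ψ) (x y : E) :
    |profile R ψ y - profile R ψ x - fderiv ℝ (profile R ψ) x (y - x)| ≤ 5 / 4 * ‖y - x‖ ^ 2 := by
  rw [hψ.profile_sub]
  have := abs_le.1 (hψ.taylor x y)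
  rw [abs_le]
  constructor <;> nlinarith [sq_nonneg ‖y - x‖]

theorem IsSmallBump.le_profile_sub (hψ : IsSmallBump p δ ψ) (x y : E) :
    fderiv ℝ (profile R ψ) x (y - x) ≤ profile R ψ y - profile R ψ x := by
  have h1 := hψ.profile_sub (R := R) x y
  have := abs_le.1 (hψ.taylor x y)
  nlinarith [sq_nonneg ‖y - x‖]

theorem IsSmallBump.convex_sublevel (hψ : IsSmallBump p δ ψ) :
    Convex ℝ {x | profile R ψ x ≤ 0} := by
  intro x hx y hy s t hs ht hst
  set w := s • x + t • y with hw
  have h1 := hψ.le_profile_sub (R := R) w x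
  have h2 := hψ.le_profile_sub (R := R) w y
  have h3 : s * fderiv ℝ (profile R ψ) w (x - w) + t * fderiv ℝ (profile R ψ) w (y - w) = 0 := by
    rw [← smul_eq_mul, ← smul_eq_mul, ← map_smul, ← map_smul, ← map_add]
    have : s • (x - w) + t • (y - w) = 0 := by
      have e : s • (x - w) + t • (y - w) = (s • x + t • y) - (s + t) • w := by module
      rw [e, hst, one_smul, hw, sub_self]
    rw [this, map_zero]
  change profile R ψ w ≤ 0
  have hx' : profile R ψ x ≤ 0 := hx
  have hy' : profile R ψ y ≤ 0 := hy
  have hst' : (s + t) * profile R ψ w = profile R ψ w := by rw [hst, one_mul]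
  nlinarith

theorem IsSmallBump.le_norm_fderiv_profile (hψ : IsSmallBump p δ ψ) (hδ : 0 ≤ δ) (x : E) :
    2 * ‖x‖ - δ / 4 ≤ ‖fderiv ℝ (profile R ψ) x‖ := by
  have h1 : ‖fderiv ℝ ψ x‖ ≤ δ / 4 := by
    refine norm_fderiv_le_of_lipschitz ℝ (C := ⟨δ / 4, by positivity⟩) ?_
    exact LipschitzWith.of_dist_le_mul fun x y => by
      rw [dist_eq_norm, dist_eq_norm, Real.norm_eq_abs]; exact hψ.lipschitz x y
  rcases eq_or_ne x 0 with rfl | hx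
  · have := norm_nonneg (fderiv ℝ (profile R ψ) 0)
    rw [norm_zero]; linarith
  have hx' : 0 < ‖x‖ := norm_pos_iff.2 hx
  have h2 := (fderiv ℝ (profile R ψ) x).le_opNorm x
  have h3 := (fderiv ℝ ψ x).le_opNorm x
  rw [hψ.fderiv_profile, real_inner_self_eq_norm_sq, Real.norm_eq_abs] at h2
  have h4 := (le_abs_self _).trans h2
  have h5 := (le_abs_self _).trans (h3.trans (mul_le_mul_of_nonneg_right h1 hx'.le))
  refine le_of_mul_le_mul_right ?_ hx'
  nlinarith

theorem IsSmallBump.le_norm_of_profile_eq_zero (hψ : IsSmallBump p δ ψ) {x : E}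
    (hx : profile R ψ x = 0) : R ≤ ‖x‖ := by
  have h1 := hψ.nonneg x
  rw [profile] at hx
  refine le_of_abs_le (abs_le_of_sq_le_sq ?_ (norm_nonneg _))
  linarith

theorem IsSmallBump.norm_le_of_profile_nonpos (hψ : IsSmallBump p δ ψ) (hδ : 0 ≤ δ) (hδR : δ ≤ R)
    {x : E} (hx : profile R ψ x ≤ 0) : ‖x‖ ≤ 2 * R := by
  have h1 := hψ.le x
  rw [profile] at hx
  refine le_of_abs_le (abs_le_of_sq_le_sq ?_ (by linarith))
  nlinarith

theorem IsSmallBump.profile_nonpos_of_norm_le (hψ : IsSmallBump p δ ψ) {x : E} (hx : ‖x‖ ≤ R) :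
    profile R ψ x ≤ 0 := by
  have h1 := hψ.nonneg x
  have h2 := pow_le_pow_left₀ (norm_nonneg x) hx 2
  rw [profile]
  linarith

theorem IsSmallBump.fderiv_profile_ne_zero (hψ : IsSmallBump p δ ψ) (hδ : 0 ≤ δ) (hδR : δ ≤ R)
    (hR : 0 < R) {x : E} (hx : profile R ψ x = 0) : fderiv ℝ (profile R ψ) x ≠ 0 := by
  intro h0
  have h1 := hψ.le_norm_fderiv_profile (R := R) hδ x
  have h2 := hψ.le_norm_of_profile_eq_zero hx
  rw [h0, norm_zero] at h1
  linarith

theorem IsSmallBump.frontier_sublevel (hψ : IsSmallBump p δ ψ) (hδ : 0 ≤ δ) (hδR : δ ≤ R)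
    (hR : 0 < R) : frontier {x | profile R ψ x ≤ 0} = {x | profile R ψ x = 0} := by
  refine subset_antisymm
    (frontier_le_subset_eq hψ.contDiff_profile.continuous continuous_const) fun x hx => ?_
  have hx0 : profile R ψ x = 0 := hx
  refine ⟨subset_closure hx0.le, fun hint => hψ.fderiv_profile_ne_zero hδ hδR hR hx0 ?_⟩
  refine IsLocalMax.fderiv_eq_zero (Filter.eventually_of_mem (mem_interior_iff_mem_nhds.1 hint)
    fun y hy => ?_)
  rw [hx0]; exact hy

variable [FiniteDimensional ℝ E]

theorem IsSmallBump.isCompact_sublevel (hψ : IsSmallBump p δ ψ) (hδ : 0 ≤ δ) (hδR : δ ≤ R) :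
    IsCompact {x | profile R ψ x ≤ 0} := by
  refine (isCompact_closedBall (0 : E) (2 * R)).of_isClosed_subset
    (isClosed_le hψ.contDiff_profile.continuous continuous_const) fun x hx => ?_
  rw [mem_closedBall_zero_iff]
  exact hψ.norm_le_of_profile_nonpos hδ hδR hx

theorem IsSmallBump.isCompact_zeroSet (hψ : IsSmallBump p δ ψ) (hδ : 0 ≤ δ) (hδR : δ ≤ R) :
    IsCompact {x | profile R ψ x = 0} :=
  (hψ.isCompact_sublevel hδ hδR).of_isClosed_subset
    (isClosed_eq hψ.contDiff_profile.continuous continuous_const) fun _ hx => le_of_eq hx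

/-- The boundary of a convex body is homeomorphic to a sphere. -/
theorem IsSmallBump.isConnected_zeroSet (hψ : IsSmallBump p δ ψ) (hδ : 0 ≤ δ) (hδR : δ ≤ R)
    (hR : 0 < R) (hE : 1 < Module.rank ℝ E) : IsConnected {x | profile R ψ x = 0} := by
  have hint : (interior {x | profile R ψ x ≤ 0}).Nonempty := by
    refine ⟨0, mem_interior.2 ⟨Metric.ball 0 R, fun x hx => ?_, Metric.isOpen_ball,
      Metric.mem_ball_self hR⟩⟩
    exact hψ.profile_nonpos_of_norm_le (mem_ball_zero_iff.1 hx).le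
  obtain ⟨e, -, -, he⟩ := exists_homeomorph_image_interior_closure_frontier_eq_unitBall
    hψ.convex_sublevel hint (hψ.isCompact_sublevel hδ hδR).isBounded
  rw [hψ.frontier_sublevel hδ hδR hR] at he
  have h1 := (isConnected_sphere hE (0 : E) zero_le_one).image e.symm e.symm.continuous.continuousOn
  rwa [← he, ← image_comp, e.symm_comp_self, image_id] at h1

end Profile

/-! ### Membership in the geometric model -/

section Model

variable {D m : ℕ} {τ δ : ℝ} {p : Ambient (m + 1)} {ψ : Ambient (m + 1) → ℝ}

theorem IsSmallBump.ofReal_le_reach (hψ : IsSmallBump p δ ψ) (hδ : 0 ≤ δ) (hδR : δ ≤ 2 * τ)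
    (hτ : 0 < τ) (hm : m + 1 ≤ D) :
    ENNReal.ofReal τ ≤ reach (incl hm '' {x | profile (2 * τ) ψ x = 0}) := by
  refine ofReal_le_reach_zeroSet hm hψ.contDiff_profile (L := 5 / 4) (by norm_num) ?_ ?_
    fun x hx => hψ.fderiv_profile_ne_zero hδ hδR (by positivity) hx
  · intro x y hx hy
    have h1 := hψ.profile_taylor_le (R := 2 * τ) x y
    rwa [hx, hy, sub_zero, zero_sub, abs_neg] at h1
  · intro x hx
    have h1 := hψ.le_norm_fderiv_profile (R := 2 * τ) hδ x
    have h2 := hψ.le_norm_of_profile_eq_zero hx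
    linarith

theorem IsSmallBump.boundaryPoints_sublevel {R : ℝ} (hψ : IsSmallBump p δ ψ) (hδ : 0 ≤ δ)
    (hδR : δ ≤ R) (hR : 0 < R) (hm : m + 1 ≤ D) :
    boundaryPoints (m + 1) (incl hm '' {x | profile R ψ x ≤ 0}) =
      incl hm '' {x | profile R ψ x = 0} := by
  refine subset_antisymm ?_ ?_
  · intro q hq
    obtain ⟨x, hx, rfl⟩ := hq.1
    refine ⟨x, ?_, rfl⟩
    by_contra hne
    exact disjoint_left.1 (disjoint_interiorPoints_boundaryPoints hm _)
      (incl_mem_interiorPoints_sublevel hm hψ.contDiff_profile.continuous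
        (lt_of_le_of_ne hx hne)) hq
  · rintro _ ⟨x, hx, rfl⟩
    exact incl_mem_boundaryPoints_sublevel hm hψ.contDiff_profile hx
      (hψ.fderiv_profile_ne_zero hδ hδR hR hx)

theorem IsSmallBump.image_sublevel_mem_geometricModel (hψ : IsSmallBump p δ ψ) (hδ : 0 ≤ δ)
    (hδR : δ ≤ 2 * τ) (hτ : 0 < τ) (hm : m + 1 ≤ D) (τmin : ℝ≥0∞) :
    incl hm '' {x | profile (2 * τ) ψ x ≤ 0} ∈
      geometricModel (m + 1) D τmin (ENNReal.ofReal τ) := by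
  have hc := (hψ.isCompact_sublevel hδ hδR).image (incl hm).continuous
  have hconv : Convex ℝ (incl hm '' {x | profile (2 * τ) ψ x ≤ 0}) :=
    (hψ.convex_sublevel (R := 2 * τ)).linear_image (incl hm).toLinearMap
  refine ⟨hc, ⟨⟨incl hm 0, 0, hψ.profile_nonpos_of_norm_le ?_, rfl⟩, hconv.isPreconnected⟩,
    ⟨hc.isClosed, ?_⟩, ?_, ?_⟩
  · rw [norm_zero]; positivity
  · rintro _ ⟨x, hx, rfl⟩
    rcases lt_or_eq_of_le (show profile (2 * τ) ψ x ≤ 0 from hx) with hx | hx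
    · exact Or.inl (incl_mem_interiorPoints_sublevel hm hψ.contDiff_profile.continuous hx)
    · exact Or.inr (incl_mem_boundaryPoints_sublevel hm hψ.contDiff_profile hx
        (hψ.fderiv_profile_ne_zero hδ hδR (by positivity) hx))
  · rw [reach_eq_top_of_convex hconv]; exact le_top
  · rw [hψ.boundaryPoints_sublevel hδ hδR (by positivity) hm]
    exact hψ.ofReal_le_reach hδ hδR hτ hm

end Model

section ModelBoundaryless

variable {D m : ℕ} {τ δ : ℝ} {p : Ambient (m + 1 + 1)} {ψ : Ambient (m + 1 + 1) → ℝ}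

theorem IsSmallBump.boundaryPoints_zeroSet {R : ℝ} (hψ : IsSmallBump p δ ψ) (hδ : 0 ≤ δ)
    (hδR : δ ≤ R) (hR : 0 < R) (hm : m + 1 + 1 ≤ D) :
    boundaryPoints (m + 1) (incl hm '' {x | profile R ψ x = 0}) = ∅ := by
  rw [eq_empty_iff_forall_notMem]
  intro q hq
  obtain ⟨x, hx, rfl⟩ := hq.1
  exact disjoint_left.1 (disjoint_interiorPoints_boundaryPoints (by omega) _)
    (incl_mem_interiorPoints_zeroSet hm hψ.contDiff_profile hx
      (hψ.fderiv_profile_ne_zero hδ hδR hR hx)) hq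

theorem IsSmallBump.image_zeroSet_mem_geometricModel (hψ : IsSmallBump p δ ψ) (hδ : 0 ≤ δ)
    (hδR : δ ≤ 2 * τ) (hτ : 0 < τ) (hm : m + 1 + 1 ≤ D) :
    incl hm '' {x | profile (2 * τ) ψ x = 0} ∈
      geometricModel (m + 1) D (ENNReal.ofReal τ) ⊤ := by
  have hc := (hψ.isCompact_zeroSet hδ hδR).image (incl hm).continuous
  refine ⟨hc, ?_, ⟨hc.isClosed, ?_⟩, hψ.ofReal_le_reach hδ hδR hτ hm, ?_⟩
  · refine (hψ.isConnected_zeroSet hδ hδR (by positivity) ?_).image _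
      (incl hm).continuous.continuousOn
    rw [← Module.finrank_eq_rank, finrank_euclideanSpace_fin]
    exact_mod_cast (by omega : 1 < m + 1 + 1)
  · rintro _ ⟨x, hx, rfl⟩
    exact Or.inl (incl_mem_interiorPoints_zeroSet hm hψ.contDiff_profile hx
      (hψ.fderiv_profile_ne_zero hδ hδR (by positivity) hx))
  · rw [hψ.boundaryPoints_zeroSet hδ hδR (by positivity) hm, reach_empty]

end ModelBoundaryless

/-! ### Deleting a coordinate -/

/-- The linear map `ℝ^(m+1) → ℝ^m` that deletes the coordinate `i`. -/
def dropCoord {m : ℕ} (i : Fin (m + 1)) : Ambient (m + 1) →ₗ[ℝ] Ambient m where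
  toFun x := WithLp.toLp 2 fun j => x (i.succAbove j)
  map_add' _ _ := rfl
  map_smul' _ _ := rfl

/-- The vector of `ℝ^(m+1)` with coordinate `a` at `i` and the coordinates of `y` elsewhere. -/
def insertCoord {m : ℕ} (i : Fin (m + 1)) (a : ℝ) (y : Ambient m) : Ambient (m + 1) :=
  WithLp.toLp 2 (i.insertNth a y.ofLp)

section DropCoord

variable {m : ℕ} (i : Fin (m + 1))

theorem dropCoord_apply (x : Ambient (m + 1)) (j : Fin m) :
    dropCoord i x j = x (i.succAbove j) := rfl

theorem insertCoord_apply_same (a : ℝ) (y : Ambient m) : insertCoord i a y i = a :=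
  Fin.insertNth_apply_same (α := fun _ => ℝ) i a y.ofLp

theorem dropCoord_insertCoord (a : ℝ) (y : Ambient m) : dropCoord i (insertCoord i a y) = y := by
  ext j
  exact Fin.insertNth_apply_succAbove (α := fun _ => ℝ) i a y.ofLp j

theorem norm_sq_eq_add_dropCoord (x : Ambient (m + 1)) :
    ‖x‖ ^ 2 = x i ^ 2 + ‖dropCoord i x‖ ^ 2 := by
  rw [EuclideanSpace.real_norm_sq_eq, EuclideanSpace.real_norm_sq_eq, Fin.sum_univ_succAbove _ i]
  rfl

theorem norm_dropCoord_le (x : Ambient (m + 1)) : ‖dropCoord i x‖ ≤ ‖x‖ := by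
  refine le_of_abs_le (abs_le_of_sq_le_sq ?_ (norm_nonneg _))
  rw [norm_sq_eq_add_dropCoord i x]
  linarith [sq_nonneg (x i)]

theorem norm_le_add_dropCoord (x : Ambient (m + 1)) : ‖x‖ ≤ |x i| + ‖dropCoord i x‖ := by
  refine le_of_abs_le (abs_le_of_sq_le_sq ?_ (by positivity))
  rw [norm_sq_eq_add_dropCoord i x, add_sq, sq_abs]
  have : 0 ≤ 2 * |x i| * ‖dropCoord i x‖ := by positivity
  linarith

theorem lipschitzWith_dropCoord : LipschitzWith 1 (dropCoord i) :=
  LipschitzWith.of_dist_le_mul fun x y => by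
    rw [dist_eq_norm, dist_eq_norm, ← map_sub, NNReal.coe_one, one_mul]
    exact norm_dropCoord_le i _

/-- The difference of two squared norms, split along the coordinate `i`. -/
theorem mul_sub_coord_eq (x y : Ambient (m + 1)) :
    (x i - y i) * (x i + y i) = (‖dropCoord i y‖ - ‖dropCoord i x‖) *
      (‖dropCoord i y‖ + ‖dropCoord i x‖) + (‖x‖ ^ 2 - ‖y‖ ^ 2) := by
  rw [norm_sq_eq_add_dropCoord i x, norm_sq_eq_add_dropCoord i y]
  ring

end DropCoord

/-! ### Measure bounds -/

/-- The volume of the unit ball of `ℝ^m`. -/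
def unitBallVolume (m : ℕ) : ℝ := (volume (Metric.ball (0 : Ambient m) 1)).toReal

theorem unitBallVolume_pos (m : ℕ) : 0 < unitBallVolume m :=
  ENNReal.toReal_pos (Metric.measure_ball_pos _ _ one_pos).ne' measure_ball_lt_top.ne

theorem ofReal_unitBallVolume (m : ℕ) :
    ENNReal.ofReal (unitBallVolume m) = volume (Metric.ball (0 : Ambient m) 1) :=
  ENNReal.ofReal_toReal measure_ball_lt_top.ne

theorem volume_closedBall_eq {m : ℕ} (x : Ambient m) {r : ℝ} (hr : 0 ≤ r) :
    volume (Metric.closedBall x r) = ENNReal.ofReal (r ^ m * unitBallVolume m) := by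
  rw [Measure.addHaar_closedBall _ _ hr, finrank_euclideanSpace_fin,
    ENNReal.ofReal_mul (by positivity), ofReal_unitBallVolume]

theorem volume_ball_eq {m : ℕ} (x : Ambient m) {r : ℝ} (hr : 0 < r) :
    volume (Metric.ball x r) = ENNReal.ofReal (r ^ m * unitBallVolume m) := by
  rw [Measure.addHaar_ball_of_pos _ _ hr, finrank_euclideanSpace_fin,
    ENNReal.ofReal_mul (by positivity), ofReal_unitBallVolume]

/-- The area of a Lipschitz graph over a ball of a coordinate hyperplane. -/
theorem measure_le_of_lipschitz_graph {m : ℕ} (i : Fin (m + 1)) {S : Set (Ambient (m + 1))}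
    {L r : ℝ} (hL : 0 ≤ L) (hr : 0 ≤ r)
    (hS : ∀ x ∈ S, ∀ y ∈ S, |x i - y i| ≤ L * ‖dropCoord i x - dropCoord i y‖)
    (hSr : ∀ x ∈ S, ‖dropCoord i x‖ ≤ r) :
    (μHE[m] : Measure (Ambient (m + 1))) S ≤
      ENNReal.ofReal ((1 + L) ^ m * (r ^ m * unitBallVolume m)) := by
  have hdist : ∀ x ∈ S, ∀ y ∈ S, dist x y ≤ (1 + L) * dist (dropCoord i x) (dropCoord i y) := by
    intro x hx y hy
    rw [dist_eq_norm, dist_eq_norm]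
    have h1 := norm_le_add_dropCoord i (x - y)
    rw [map_sub] at h1
    have h2 := hS x hx y hy
    rw [PiLp.sub_apply] at h1
    linarith
  have hinj : InjOn (dropCoord i) S := by
    intro x hx y hy hxy
    have h1 := hdist x hx y hy
    rw [hxy, dist_self, mul_zero] at h1
    exact dist_le_zero.1 h1
  set g := Function.invFunOn (dropCoord i) S
  have hg : ∀ x ∈ S, g (dropCoord i x) = x := fun x hx => hinj.leftInvOn_invFunOn hx
  have hgl : LipschitzOnWith ⟨1 + L, by positivity⟩ g (dropCoord i '' S) := by
    refine LipschitzOnWith.of_dist_le_mul ?_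
    rintro _ ⟨x, hx, rfl⟩ _ ⟨y, hy, rfl⟩
    rw [hg x hx, hg y hy]
    exact hdist x hx y hy
  have himg : g '' (dropCoord i '' S) = S := by
    rw [image_image]
    exact (image_congr hg).trans (image_id' S)
  have h1 := euclideanHausdorffMeasure_image_le hgl m
  rw [himg] at h1
  have h2 : (μHE[m] : Measure (Ambient m)) (dropCoord i '' S) ≤
      ENNReal.ofReal (r ^ m * unitBallVolume m) := by
    rw [EuclideanSpace.euclideanHausdorffMeasure_eq_volume, ← volume_closedBall_eq 0 hr]
    refine measure_mono ?_
    rintro _ ⟨x, hx, rfl⟩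
    rw [mem_closedBall_zero_iff]
    exact hSr x hx
  refine h1.trans ((mul_le_mul_right h2 _).trans (le_of_eq ?_))
  rw [ENNReal.ofReal_mul (p := (1 + L) ^ m) (by positivity),
    ENNReal.ofReal_pow (p := 1 + L) (by positivity)]
  congr 2
  exact (ENNReal.ofReal_eq_coe_nnreal _).symm

theorem abs_sub_coord_le_of_sphere {m : ℕ} (i : Fin (m + 1)) {R c : ℝ} (hR : 0 < R)
    {x y : Ambient (m + 1)} (hx : ‖x‖ = R) (hy : ‖y‖ = R) (hc : 0 < c)
    (hxy : 2 * R ≤ c * |x i + y i|) :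
    |x i - y i| ≤ c * ‖dropCoord i x - dropCoord i y‖ := by
  have h1 := mul_sub_coord_eq i x y
  rw [hx, hy, sub_self, add_zero] at h1
  have h2 : |x i - y i| * |x i + y i| ≤ ‖dropCoord i x - dropCoord i y‖ * (2 * R) := by
    rw [← abs_mul, h1, abs_mul]
    have h3 := abs_norm_sub_norm_le (dropCoord i y) (dropCoord i x)
    rw [norm_sub_rev] at h3
    have h4 : |‖dropCoord i y‖ + ‖dropCoord i x‖| ≤ 2 * R := by
      rw [abs_of_nonneg (by positivity)]
      have := norm_dropCoord_le i x
      have := norm_dropCoord_le i y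
      linarith
    gcongr
  have h5 : |x i - y i| * (2 * R) ≤ (c * ‖dropCoord i x - dropCoord i y‖) * (2 * R) := by
    calc |x i - y i| * (2 * R) ≤ |x i - y i| * (c * |x i + y i|) := by gcongr
      _ = c * (|x i - y i| * |x i + y i|) := by ring
      _ ≤ c * (‖dropCoord i x - dropCoord i y‖ * (2 * R)) := by gcongr
      _ = _ := by ring
  exact le_of_mul_le_mul_right h5 (by positivity)

/-- Up to a dimensional constant, the area of a sphere of radius `R` is at most `R ^ m`: some
coordinate of each point is at least `R / (m + 1)` in absolute value, so the sphere is a union of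
`2 (m + 1)` Lipschitz graphs. -/
theorem measure_sphere_le (m : ℕ) {R : ℝ} (hR : 0 < R) :
    (μHE[m] : Measure (Ambient (m + 1))) (Metric.sphere 0 R) ≤
      ENNReal.ofReal (2 * (m + 1) * ((1 + (m + 1)) ^ m * (R ^ m * unitBallVolume m))) := by
  let S : Fin (m + 1) → ℝ → Set (Ambient (m + 1)) := fun i σ =>
    {x | ‖x‖ = R ∧ R ≤ (m + 1) * (σ * x i)}
  have hcover : Metric.sphere 0 R ⊆ ⋃ i, (S i 1 ∪ S i (-1)) := by
    intro x hx
    rw [mem_sphere_zero_iff_norm] at hx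
    obtain ⟨i, hi⟩ : ∃ i, R ≤ (m + 1) * |x i| := by
      by_contra! H
      have h1 : ‖x‖ ^ 2 * (m + 1) ^ 2 < (m + 1) * R ^ 2 := by
        rw [EuclideanSpace.real_norm_sq_eq, Finset.sum_mul]
        have : ((m : ℝ) + 1) * R ^ 2 = ∑ _i : Fin (m + 1), R ^ 2 := by simp
        rw [this]
        refine Finset.sum_lt_sum_of_nonempty Finset.univ_nonempty fun i _ => ?_
        have h2 := pow_lt_pow_left₀ (H i) (by positivity) two_ne_zero
        rw [mul_pow, sq_abs] at h2
        linarith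
      rw [hx] at h1
      have h2 : 0 < R ^ 2 := by positivity
      have h3 : (0 : ℝ) ≤ m := by positivity
      nlinarith [mul_nonneg h3 h2.le, mul_nonneg (mul_nonneg h3 h3) h2.le]
    refine mem_iUnion.2 ⟨i, ?_⟩
    rcases abs_cases (x i) with ⟨h, -⟩ | ⟨h, -⟩
    · exact Or.inl ⟨hx, by rw [one_mul, ← h]; exact hi⟩
    · exact Or.inr ⟨hx, by rw [neg_one_mul, ← h]; exact hi⟩
  have hS : ∀ i σ, |σ| = 1 → (μHE[m] : Measure (Ambient (m + 1))) (S i σ) ≤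
      ENNReal.ofReal ((1 + (m + 1)) ^ m * (R ^ m * unitBallVolume m)) := by
    intro i σ hσ
    refine measure_le_of_lipschitz_graph i (by positivity) hR.le ?_ ?_
    · rintro x ⟨hx, hx'⟩ y ⟨hy, hy'⟩
      refine abs_sub_coord_le_of_sphere i hR hx hy (by positivity) ?_
      have h1 : σ * x i + σ * y i ≤ |x i + y i| := by
        rw [← mul_add]
        refine (le_abs_self _).trans ?_
        rw [abs_mul, hσ, one_mul]
      calc 2 * R ≤ ((m : ℝ) + 1) * (σ * x i + σ * y i) := by linarith
        _ ≤ _ := by gcongr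
    · rintro x ⟨hx, -⟩
      exact (norm_dropCoord_le i x).trans hx.le
  have hnn : 0 ≤ (1 + ((m : ℝ) + 1)) ^ m * (R ^ m * unitBallVolume m) := by
    have := unitBallVolume_pos m
    positivity
  calc (μHE[m] : Measure (Ambient (m + 1))) (Metric.sphere 0 R)
      ≤ ∑ i, (μHE[m] : Measure (Ambient (m + 1))) (S i 1 ∪ S i (-1)) :=
        (measure_mono hcover).trans (measure_iUnion_fintype_le _ _)
    _ ≤ ∑ _i : Fin (m + 1), ENNReal.ofReal
          (2 * ((1 + (m + 1)) ^ m * (R ^ m * unitBallVolume m))) := by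
        refine Finset.sum_le_sum fun i _ => (measure_union_le _ _).trans ?_
        rw [two_mul, ENNReal.ofReal_add hnn hnn]
        exact add_le_add (hS i 1 (by simp)) (hS i (-1) (by simp))
    _ = _ := by
        rw [Finset.sum_const, Finset.card_univ, Fintype.card_fin, nsmul_eq_mul,
          ← ENNReal.ofReal_natCast, ← ENNReal.ofReal_mul (by positivity)]
        congr 1
        push_cast
        ring

/-- The pole of the sphere of radius `R` on the last coordinate axis. -/
abbrev pole (m : ℕ) (R : ℝ) : Ambient (m + 1) := EuclideanSpace.single (Fin.last m) R

theorem dist_pole_sq {m : ℕ} (R : ℝ) (x : Ambient (m + 1)) :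
    dist x (pole m R) ^ 2 = ‖x‖ ^ 2 - 2 * R * x (Fin.last m) + R ^ 2 := by
  rw [dist_eq_norm, norm_sub_sq_real, EuclideanSpace.inner_single_right, PiLp.norm_single,
    Real.norm_eq_abs, sq_abs]
  simp
  ring

/-- The lower half-sphere projects onto the equatorial ball. -/
theorem le_measure_sphere_diff_ball (m : ℕ) {R δ : ℝ} (hR : 0 < R) (hδR : δ ≤ R) :
    ENNReal.ofReal (R ^ m * unitBallVolume m) ≤
      (μHE[m] : Measure (Ambient (m + 1))) (Metric.sphere 0 R \ Metric.ball (pole m R) δ) := by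
  have hsub : Metric.ball (0 : Ambient m) R ⊆ dropCoord (Fin.last m) ''
      (Metric.sphere 0 R \ Metric.ball (pole m R) δ) := by
    intro y hy
    rw [mem_ball_zero_iff] at hy
    have hy2 : ‖y‖ ^ 2 ≤ R ^ 2 := by gcongr
    set x := insertCoord (Fin.last m) (-√(R ^ 2 - ‖y‖ ^ 2)) y with hx
    have hxn : ‖x‖ ^ 2 = R ^ 2 := by
      rw [norm_sq_eq_add_dropCoord (Fin.last m), hx, insertCoord_apply_same,
        dropCoord_insertCoord, neg_sq, Real.sq_sqrt (by linarith)]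
      ring
    refine ⟨x, ⟨?_, ?_⟩, dropCoord_insertCoord _ _ _⟩
    · rw [mem_sphere_zero_iff_norm]
      exact (sq_eq_sq₀ (norm_nonneg _) hR.le).1 hxn
    · rw [Metric.mem_ball, not_lt]
      refine hδR.trans (le_of_abs_le (abs_le_of_sq_le_sq ?_ dist_nonneg))
      rw [dist_pole_sq, hxn, hx, insertCoord_apply_same]
      have : 0 ≤ R * √(R ^ 2 - ‖y‖ ^ 2) := by positivity
      nlinarith
  have h1 := euclideanHausdorffMeasure_image_le
    ((lipschitzWith_dropCoord (Fin.last m)).lipschitzOnWith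
      (s := Metric.sphere 0 R \ Metric.ball (pole m R) δ)) m
  rw [ENNReal.coe_one, one_pow, one_mul] at h1
  refine le_trans ?_ h1
  rw [EuclideanSpace.euclideanHausdorffMeasure_eq_volume, ← volume_ball_eq 0 hR]
  exact measure_mono hsub

/-- Fubini bound for the volume of a thin set. -/
theorem volume_le_of_slices {m : ℕ} (i : Fin (m + 1)) {S : Set (Ambient (m + 1))}
    (hS : MeasurableSet S) {δ η : ℝ} (hδ : 0 ≤ δ)
    (h1 : ∀ x ∈ S, ‖dropCoord i x‖ ≤ δ)
    (h2 : ∀ x ∈ S, ∀ y ∈ S, dropCoord i x = dropCoord i y → |x i - y i| ≤ η) :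
    volume S ≤ ENNReal.ofReal (η * (2 * δ) ^ m) := by
  by_cases hne : S.Nonempty
  swap
  · rw [not_nonempty_iff_eq_empty.1 hne]; simp
  obtain ⟨x₀, hx₀⟩ := hne
  have hη : 0 ≤ η := (abs_nonneg _).trans (h2 x₀ hx₀ x₀ hx₀ rfl)
  let e : Ambient (m + 1) ≃ᵐ ℝ × (Fin m → ℝ) := (MeasurableEquiv.toLp 2 (Fin (m + 1) → ℝ)).symm.trans
    (MeasurableEquiv.piFinSuccAbove (fun _ => ℝ) i)
  have he : MeasurePreserving e volume volume :=
    (EuclideanSpace.volume_preserving_symm_measurableEquiv_toLp (Fin (m + 1))).trans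
      (volume_preserving_piFinSuccAbove (fun _ => ℝ) i)
  have hes : ∀ a (y : Fin m → ℝ), e.symm (a, y) = insertCoord i a (WithLp.toLp 2 y) :=
    fun a y => rfl
  rw [← (he.symm e).measure_preimage_equiv, Measure.volume_eq_prod,
    Measure.prod_apply_symm (e.symm.measurable hS)]
  calc ∫⁻ y, volume ((fun a => (a, y)) ⁻¹' (e.symm ⁻¹' S))
      ≤ ∫⁻ y, (Metric.closedBall (0 : Fin m → ℝ) δ).indicator (fun _ => ENNReal.ofReal η) y := by
        refine lintegral_mono fun y => ?_
        by_cases hy : y ∈ Metric.closedBall (0 : Fin m → ℝ) δ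
        · rw [indicator_of_mem hy]
          refine (Real.volume_le_diam _).trans (Metric.ediam_le fun a ha b hb => ?_)
          have ha' : insertCoord i a (WithLp.toLp 2 y) ∈ S := by rw [← hes]; exact ha
          have hb' : insertCoord i b (WithLp.toLp 2 y) ∈ S := by rw [← hes]; exact hb
          have := h2 _ ha' _ hb' (by rw [dropCoord_insertCoord, dropCoord_insertCoord])
          rw [insertCoord_apply_same, insertCoord_apply_same] at this
          rw [edist_dist, Real.dist_eq]
          exact ENNReal.ofReal_le_ofReal this
        · rw [indicator_of_notMem hy]
          have : (fun a => (a, y)) ⁻¹' (e.symm ⁻¹' S) = ∅ := by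
            rw [eq_empty_iff_forall_notMem]
            intro a ha
            have ha' : insertCoord i a (WithLp.toLp 2 y) ∈ S := by rw [← hes]; exact ha
            refine hy ?_
            have h3 := h1 _ ha'
            rw [dropCoord_insertCoord] at h3
            rw [mem_closedBall_zero_iff, pi_norm_le_iff_of_nonneg hδ]
            exact fun j => (PiLp.norm_apply_le (WithLp.toLp 2 y) j).trans h3
          rw [this, measure_empty]
    _ = ENNReal.ofReal η * volume (Metric.closedBall (0 : Fin m → ℝ) δ) := by
        rw [lintegral_indicator Metric.isClosed_closedBall.measurableSet, setLIntegral_const]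
    _ = _ := by
        rw [Real.volume_pi_closedBall _ hδ, Fintype.card_fin, ENNReal.ofReal_mul hη]

section Cap

variable {m : ℕ} {R δ : ℝ} {ψ : Ambient (m + 1) → ℝ}

theorem half_le_last_of_dist_pole_lt {x : Ambient (m + 1)} (hδR : δ ≤ R / 2)
    (hx : dist x (pole m R) < δ) :
    R / 2 ≤ x (Fin.last m) ∧ ‖dropCoord (Fin.last m) x‖ ≤ δ := by
  have h0 : dropCoord (Fin.last m) (pole m R) = 0 := by
    ext j
    simp [dropCoord_apply]
  rw [dist_eq_norm] at hx
  constructor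
  · have h1 := PiLp.norm_apply_le (x - pole m R) (Fin.last m)
    simp only [PiLp.sub_apply, PiLp.single_apply, if_true, Real.norm_eq_abs] at h1
    have := (abs_le.1 (h1.trans hx.le)).1
    linarith
  · have h1 := norm_dropCoord_le (Fin.last m) (x - pole m R)
    rw [map_sub, h0, sub_zero] at h1
    exact h1.trans hx.le

theorem IsSmallBump.zeroSet_diff_ball (hψ : IsSmallBump (pole m R) δ ψ) (hR : 0 ≤ R) :
    {x | profile R ψ x = 0} \ Metric.ball (pole m R) δ =
      Metric.sphere 0 R \ Metric.ball (pole m R) δ := by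
  ext x
  simp only [Set.mem_sdiff, mem_ofPred_eq, mem_sphere_zero_iff_norm]
  refine and_congr_left fun hx => ?_
  rw [Metric.mem_ball, not_lt] at hx
  rw [profile, hψ.eq_zero x hx, sub_zero, sub_eq_zero, sq_eq_sq₀ (norm_nonneg _) hR]

/-- The part of the perturbed sphere near the pole is a Lipschitz graph over a ball of
radius `δ`. -/
theorem IsSmallBump.measure_zeroSet_inter_ball_le (hψ : IsSmallBump (pole m R) δ ψ) (hδ : 0 < δ)
    (hδR : δ ≤ R / 2) :
    (μHE[m] : Measure (Ambient (m + 1))) ({x | profile R ψ x = 0} ∩ Metric.ball (pole m R) δ) ≤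
      ENNReal.ofReal ((1 + 2) ^ m * (δ ^ m * unitBallVolume m)) := by
  refine measure_le_of_lipschitz_graph (Fin.last m) zero_le_two hδ.le ?_ ?_
  · rintro x ⟨hx, hxb⟩ y ⟨hy, hyb⟩
    obtain ⟨hx1, hx2⟩ := half_le_last_of_dist_pole_lt hδR hxb
    obtain ⟨hy1, hy2⟩ := half_le_last_of_dist_pole_lt hδR hyb
    have hx0 : ‖x‖ ^ 2 - R ^ 2 - ψ x = 0 := hx
    have hy0 : ‖y‖ ^ 2 - R ^ 2 - ψ y = 0 := hy
    have h1 := mul_sub_coord_eq (Fin.last m) x y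
    have h2 : ‖x‖ ^ 2 - ‖y‖ ^ 2 = ψ x - ψ y := by linarith
    rw [h2] at h1
    set u := dropCoord (Fin.last m) x
    set v := dropCoord (Fin.last m) y
    set s := |x (Fin.last m) - y (Fin.last m)|
    have h3 : |ψ x - ψ y| ≤ δ / 4 * (s + ‖u - v‖) := by
      refine (hψ.lipschitz x y).trans (mul_le_mul_of_nonneg_left ?_ (by positivity))
      have := norm_le_add_dropCoord (Fin.last m) (x - y)
      rwa [map_sub] at this
    have h4 : |(‖v‖ - ‖u‖) * (‖v‖ + ‖u‖)| ≤ ‖u - v‖ * (2 * δ) := by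
      rw [abs_mul, abs_of_nonneg (by positivity : 0 ≤ ‖v‖ + ‖u‖)]
      have := abs_norm_sub_norm_le v u
      rw [norm_sub_rev] at this
      gcongr
      linarith
    have h5 : s * R ≤ ‖u - v‖ * (2 * δ) + δ / 4 * (s + ‖u - v‖) := by
      calc s * R ≤ s * |x (Fin.last m) + y (Fin.last m)| := by
            gcongr
            exact le_trans (by linarith) (le_abs_self _)
        _ = |(‖v‖ - ‖u‖) * (‖v‖ + ‖u‖) + (ψ x - ψ y)| := by rw [← abs_mul, h1]
        _ ≤ _ := (abs_add_le _ _).trans (add_le_add h4 h3)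
    have hs : 0 ≤ s := abs_nonneg _
    have hR : 0 < R := by linarith
    have h6 : s * (R * (7 / 8)) ≤ 2 * ‖u - v‖ * (R * (7 / 8)) := by
      nlinarith [mul_le_mul_of_nonneg_left hδR hs, mul_le_mul_of_nonneg_left hδR (norm_nonneg (u - v)),
        mul_nonneg (norm_nonneg (u - v)) hR.le]
    exact le_of_mul_le_mul_right h6 (by positivity)
  · rintro x ⟨-, hxb⟩
    exact (half_le_last_of_dist_pole_lt hδR hxb).2

/-- The part added to the ball by the bump has width `δ` and height of order `δ² / R`. -/
theorem IsSmallBump.volume_sublevel_diff_le (hψ : IsSmallBump (pole m R) δ ψ) (hδ : 0 < δ)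
    (hδR : δ ≤ R / 2) :
    volume ({x | profile R ψ x ≤ 0} \ Metric.closedBall 0 R) ≤
      ENNReal.ofReal (δ ^ 2 / (4 * R) * (2 * δ) ^ m) := by
  have hR : 0 < R := by linarith
  have hnorm : ∀ x ∈ {x | profile R ψ x ≤ 0} \ Metric.closedBall 0 R,
      R ^ 2 < ‖x‖ ^ 2 ∧ ‖x‖ ^ 2 ≤ R ^ 2 + δ ^ 2 / 4 ∧ dist x (pole m R) < δ := by
    rintro x ⟨hx, hxR⟩
    have hx' : ‖x‖ ^ 2 - R ^ 2 - ψ x ≤ 0 := hx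
    rw [mem_closedBall_zero_iff, not_le] at hxR
    have h1 : R ^ 2 < ‖x‖ ^ 2 := by gcongr
    refine ⟨h1, by linarith [hψ.le x], ?_⟩
    by_contra! H
    rw [hψ.eq_zero x H] at hx'
    linarith
  refine volume_le_of_slices (Fin.last m) ?_ hδ.le ?_ ?_
  · exact (isClosed_le hψ.contDiff_profile.continuous continuous_const).measurableSet.diff
      Metric.isClosed_closedBall.measurableSet
  · exact fun x hx => (half_le_last_of_dist_pole_lt hδR (hnorm x hx).2.2).2
  · intro x hx y hy hxy
    obtain ⟨a1, a2, a3⟩ := hnorm x hx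
    obtain ⟨b1, b2, b3⟩ := hnorm y hy
    have ha := (half_le_last_of_dist_pole_lt hδR a3).1
    have hb := (half_le_last_of_dist_pole_lt hδR b3).1
    have h1 := mul_sub_coord_eq (Fin.last m) x y
    rw [hxy, sub_self, zero_mul, zero_add] at h1
    have h2 : |x (Fin.last m) - y (Fin.last m)| * R ≤ δ ^ 2 / 4 := by
      calc |x (Fin.last m) - y (Fin.last m)| * R
          ≤ |x (Fin.last m) - y (Fin.last m)| * |x (Fin.last m) + y (Fin.last m)| := by
            gcongr
            exact le_trans (by linarith) (le_abs_self _)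
        _ = |‖x‖ ^ 2 - ‖y‖ ^ 2| := by rw [← abs_mul, h1]
        _ ≤ δ ^ 2 / 4 := by rw [abs_le]; constructor <;> linarith
    rw [← div_div, le_div_iff₀ hR]
    exact h2

/-- The top of the bump is at distance of order `δ² / R` from the ball of radius `R`. -/
theorem IsSmallBump.le_hausdorffEDist (hψ : IsSmallBump (pole m R) δ ψ) (hδ : 0 < δ)
    (hδR : δ ≤ R / 2) {a : ℝ} (ha : 0 < a)
    (hψa : ∀ x, dist x (pole m R) ≤ δ / 2 → ψ x = a * δ ^ 2) {S₀ S₁ : Set (Ambient (m + 1))}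
    (hS₀ : S₀ ⊆ Metric.closedBall 0 R) (hS₁ : {x | profile R ψ x = 0} ⊆ S₁) :
    ENNReal.ofReal (a * δ ^ 2 / (3 * R)) ≤ Metric.hausdorffEDist S₀ S₁ := by
  have hR : 0 < R := by linarith
  have haδ : a * δ ^ 2 ≤ δ ^ 2 / 4 := by
    rw [← hψa (pole m R) (by rw [dist_self]; positivity)]
    exact hψ.le _
  have haδ' : 0 < a * δ ^ 2 := by positivity
  -- Near the pole `ψ` is constant, so the point at height `t` on the axis is a zero of the profile.
  set t := √(R ^ 2 + a * δ ^ 2)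
  have ht : t ^ 2 = R ^ 2 + a * δ ^ 2 := Real.sq_sqrt (by positivity)
  have ht0 : 0 ≤ t := Real.sqrt_nonneg _
  have hRt : R ≤ t := by
    refine le_of_abs_le (abs_le_of_sq_le_sq ?_ ht0)
    linarith
  have htR : t ≤ R + δ / 2 := by
    refine le_of_abs_le (abs_le_of_sq_le_sq ?_ (by positivity))
    nlinarith
  have hq : dist (pole m t) (pole m R) ≤ δ / 2 := by
    rw [PiLp.dist_single_same, Real.dist_eq, abs_of_nonneg (by linarith)]
    linarith
  have hqn : ‖pole m t‖ = t := by
    rw [PiLp.norm_single, Real.norm_of_nonneg ht0]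
  have hq1 : pole m t ∈ S₁ := by
    refine hS₁ ?_
    change ‖pole m t‖ ^ 2 - R ^ 2 - ψ (pole m t) = 0
    rw [hqn, ht, hψa _ hq]
    ring
  rw [Metric.hausdorffEDist_comm]
  refine le_trans ?_ (Metric.infEDist_le_hausdorffEDist_of_mem hq1)
  refine Metric.le_infEDist.2 fun y hy => ?_
  rw [edist_dist]
  refine ENNReal.ofReal_le_ofReal ?_
  have hy' : ‖y‖ ≤ R := mem_closedBall_zero_iff.1 (hS₀ hy)
  have h1 : t - R ≤ dist (pole m t) y := by
    rw [dist_eq_norm]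
    have := norm_sub_norm_le (pole m t) y
    rw [hqn] at this
    linarith
  refine le_trans ?_ h1
  rw [div_le_iff₀ (by positivity)]
  nlinarith

end Cap

/-! ### Minimax rates -/

/-- The truncated root `y = min 1 (x ^ (1 / e))`, which sets the width of the bumps. -/
theorem exists_pow_le_of_pos {e : ℕ} (he : e ≠ 0) {x : ℝ} (hx : 0 < x) :
    ∃ y : ℝ, 0 < y ∧ y ≤ 1 ∧ y ^ e ≤ x ∧ y ^ 2 = min 1 (x ^ ((2 : ℝ) / (e : ℝ))) := by
  have hxe : 0 < x ^ ((e : ℝ)⁻¹) := Real.rpow_pos_of_pos hx _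
  refine ⟨min 1 (x ^ ((e : ℝ)⁻¹)), lt_min one_pos hxe, min_le_left _ _, ?_, ?_⟩
  · calc min 1 (x ^ ((e : ℝ)⁻¹)) ^ e ≤ (x ^ ((e : ℝ)⁻¹)) ^ e :=
          pow_le_pow_left₀ (lt_min one_pos hxe).le (min_le_right _ _) _
      _ = x := Real.rpow_inv_natCast_pow hx.le he
  · have h1 : x ^ ((2 : ℝ) / (e : ℝ)) = (x ^ ((e : ℝ)⁻¹)) ^ 2 := by
      rw [← Real.rpow_natCast, ← Real.rpow_mul hx.le]
      congr 1
      push_cast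
      ring
    rw [h1]
    rcases le_total 1 (x ^ ((e : ℝ)⁻¹)) with h | h
    · rw [min_eq_left h, min_eq_left (one_le_pow₀ h), one_pow]
    · rw [min_eq_right h, min_eq_right (pow_le_one₀ hxe.le h)]

theorem ofReal_le_div_four {v : ℝ} {H : ℝ≥0∞} (h : ENNReal.ofReal (4 * v) ≤ H) :
    ENNReal.ofReal v ≤ H / 4 := by
  rw [ENNReal.le_div_iff_mul_le (by simp) (by simp), mul_comm]
  rwa [ENNReal.ofReal_mul (by norm_num), ENNReal.ofReal_ofNat] at h

theorem profile_zero_le_iff {E : Type*} [NormedAddCommGroup E] {R : ℝ} (hR : 0 ≤ R) :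
    {x : E | profile R (fun _ => 0) x ≤ 0} = Metric.closedBall 0 R := by
  ext x
  simp [profile, sq_le_sq₀ (norm_nonneg x) hR]

/-- Lower bound for manifolds without boundary: a sphere and a sphere with a bump. -/
theorem exists_le_minimaxRisk_boundaryless (m : ℕ) :
    ∃ c c' C : ℝ, 0 < c ∧ 0 < c' ∧ 0 < C ∧ ∀ (D : ℕ) (fmin fmax : ℝ), 0 < fmin → fmin ≤ fmax →
      m + 1 < D → ∀ τ : ℝ, 0 < τ → fmin ≤ c / τ ^ (m + 1) → c' / τ ^ (m + 1) ≤ fmax →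
        ∀ n : ℕ, 1 ≤ n →
          ENNReal.ofReal (C * τ *
              min 1 ((1 / (fmin * τ ^ (m + 1) * (n : ℝ))) ^ ((2 : ℝ) / ((m + 1 : ℕ) : ℝ)))) ≤
            minimaxRisk (boundaryless (m + 1)
              (statisticalModel (m + 1) D (ENNReal.ofReal τ) ⊤ fmin fmax)) n := by
  obtain ⟨a₀, ha₀, hbump⟩ := exists_isSmallBump (Ambient (m + 1 + 1))
  set ω := unitBallVolume (m + 1)
  have hω : 0 < ω := unitBallVolume_pos _
  -- `Ks` bounds the area of the unit sphere and `Kc` that of the graph of a bump of width one.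
  set Ks : ℝ := 2 * ((m + 1 : ℕ) + 1) * ((1 + ((m + 1 : ℕ) + 1)) ^ (m + 1) * ω) with hKs
  set Kc : ℝ := (1 + 2) ^ (m + 1) * ω with hKc
  have hKs0 : 0 < Ks := by positivity
  have hKc0 : 0 < Kc := by positivity
  -- `κ` is small enough for a bump of width `κ τ y` to have area at most `1 / (2 n fmin)`.
  set κ : ℝ := min 1 (1 / (2 * Kc))
  have hκ0 : 0 < κ := lt_min one_pos (by positivity)
  have hκ1 : κ ≤ 1 := min_le_left _ _
  have hκ2 : Kc * κ ≤ 1 / 2 := by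
    calc Kc * κ ≤ Kc * (1 / (2 * Kc)) := by gcongr; exact min_le_right _ _
      _ = 1 / 2 := by field_simp
  refine ⟨1 / ((Ks + Kc) * 2 ^ (m + 1)), 1 / (2 ^ (m + 1) * ω), a₀ * κ ^ 2 / 24, by positivity,
    by positivity, by positivity, ?_⟩
  intro D fmin fmax hf hff hD τ hτ hfc hfc' n hn
  have hm : m + 1 + 1 ≤ D := hD
  have hn' : (1 : ℝ) ≤ n := by exact_mod_cast hn
  rw [le_div_iff₀ (by positivity)] at hfc
  rw [div_le_iff₀ (by positivity)] at hfc'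
  obtain ⟨y, hy0, hy1, hyx, hy2⟩ := exists_pow_le_of_pos (e := m + 1) (by omega)
    (x := 1 / (fmin * τ ^ (m + 1) * (n : ℝ))) (by positivity)
  rw [← hy2]
  set δ := κ * τ * y with hδ
  have hδ0 : 0 < δ := by positivity
  have hδτ : δ ≤ τ := by
    calc κ * τ * y ≤ 1 * τ * 1 := by gcongr
      _ = τ := by ring
  obtain ⟨ψ, hψ, hψa⟩ := hbump (pole (m + 1) (2 * τ)) δ hδ0
  let ψs : Fin 2 → Ambient (m + 1 + 1) → ℝ := ![fun _ => 0, ψ]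
  have hψs : ∀ i, IsSmallBump (pole (m + 1) (2 * τ)) δ (ψs i) := by
    intro i
    fin_cases i
    · exact isSmallBump_zero _ hδ0.le
    · exact hψ
  let M : Fin 2 → Set (Ambient D) := fun i => incl hm '' {x | profile (2 * τ) (ψs i) x = 0}
  set U : Set (Ambient D) := Metric.ball (incl hm (pole (m + 1) (2 * τ))) δ with hU
  have hUpre : incl hm ⁻¹' U = Metric.ball (pole (m + 1) (2 * τ)) δ :=
    (incl hm).isometry.preimage_ball _ _
  have hdiff : ∀ i, M i \ U = incl hm ''
      (Metric.sphere 0 (2 * τ) \ Metric.ball (pole (m + 1) (2 * τ)) δ) := by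
    intro i
    rw [← image_sdiff_preimage, hUpre, (hψs i).zeroSet_diff_ball (by positivity)]
  have hinter : ∀ i, M i ∩ U = incl hm ''
      ({x | profile (2 * τ) (ψs i) x = 0} ∩ Metric.ball (pole (m + 1) (2 * τ)) δ) := by
    intro i
    rw [← image_inter_preimage, hUpre]
  set A := (μHE[m + 1] : Measure (Ambient D)) (M 0 \ U) with hA
  have hA1 : ENNReal.ofReal ((2 * τ) ^ (m + 1) * ω) ≤ A := by
    rw [hA, hdiff, (incl hm).isometry.euclideanHausdorffMeasure_image]
    exact le_measure_sphere_diff_ball (m + 1) (by positivity) (by linarith)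
  have hA2 : A ≤ ENNReal.ofReal (Ks * (2 * τ) ^ (m + 1)) := by
    rw [hA, hdiff, (incl hm).isometry.euclideanHausdorffMeasure_image]
    refine (measure_mono sdiff_subset).trans
      ((measure_sphere_le (m + 1) (by positivity : 0 < 2 * τ)).trans (le_of_eq ?_))
    congr 1
    rw [hKs]
    ring
  have hAfin : A ≠ ⊤ := ne_top_of_le_ne_top ENNReal.ofReal_ne_top hA2
  have hB : ∀ i, (μHE[m + 1] : Measure (Ambient D)) (M i ∩ U) ≤
      ENNReal.ofReal (Kc * δ ^ (m + 1)) := by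
    intro i
    rw [hinter, (incl hm).isometry.euclideanHausdorffMeasure_image]
    refine ((hψs i).measure_zeroSet_inter_ball_le hδ0 (by linarith)).trans (le_of_eq ?_)
    congr 1
    rw [hKc]
    ring
  have hBfin : ∀ i, (μHE[m + 1] : Measure (Ambient D)) (M i ∩ U) ≠ ⊤ := fun i =>
    ne_top_of_le_ne_top ENNReal.ofReal_ne_top (hB i)
  have ha1 : (2 * τ) ^ (m + 1) * ω ≤ A.toReal := (ENNReal.ofReal_le_iff_le_toReal hAfin).1 hA1
  have ha2 : A.toReal ≤ Ks * (2 * τ) ^ (m + 1) := ENNReal.toReal_le_of_le_ofReal (by positivity) hA2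
  have hb : ∀ i, ((μHE[m + 1] : Measure (Ambient D)) (M i ∩ U)).toReal ≤ Kc * δ ^ (m + 1) :=
    fun i => ENNReal.toReal_le_of_le_ofReal (by positivity) (hB i)
  have ha0 : 0 < A.toReal := lt_of_lt_of_le (by positivity) ha1
  have hMg : ∀ i, M i ∈ geometricModel (m + 1) D (ENNReal.ofReal τ) ⊤ := fun i =>
    (hψs i).image_zeroSet_mem_geometricModel hδ0.le (by linarith) hτ hm
  have hmain := hausdorffEDist_div_four_le_of_diff_eq (d := m + 1) (U := U) (M := M)
    (Model := boundaryless (m + 1) (statisticalModel (m + 1) D (ENNReal.ofReal τ) ⊤ fmin fmax))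
    (τ := ENNReal.ofReal τ) (τb := ⊤) (fmin := fmin) (fmax := fmax) hn
    (a := A.toReal) (b := fun i => ((μHE[m + 1] : Measure (Ambient D)) (M i ∩ U)).toReal)
    ?_ hMg (fun i p hp V hV => (hMg i).2.2.1.measure_inter_pos (by omega) hp hV)
    Metric.isOpen_ball.measurableSet (by rw [hdiff, hdiff]) ha0 (fun i => ENNReal.toReal_nonneg)
    (ENNReal.ofReal_toReal hAfin).symm (fun i => (ENNReal.ofReal_toReal (hBfin i)).symm)
    hf hff ?_ ?_ ?_
  · refine le_trans (ofReal_le_div_four ?_) hmain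
    have h1 := hψ.le_hausdorffEDist hδ0 (by linarith) ha₀ hψa
      (S₀ := {x | profile (2 * τ) (ψs 0) x = 0}) (S₁ := {x | profile (2 * τ) (ψs 1) x = 0})
      ?_ subset_rfl
    · rw [Metric.hausdorffEDist_image (incl hm).isometry]
      refine le_trans (ENNReal.ofReal_le_ofReal (le_of_eq ?_)) h1
      rw [hδ]
      field_simp
      norm_num
    · rw [← profile_zero_le_iff (by positivity)]
      exact fun x hx => le_of_eq hx
  · intro P hP i hi
    refine ⟨hP, ?_⟩
    rw [hi]
    exact (hψs i).boundaryPoints_zeroSet hδ0.le (by linarith) (by positivity) hm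
  · intro i
    have h1 : δ ^ (m + 1) ≤ (2 * τ) ^ (m + 1) := pow_le_pow_left₀ hδ0.le (by linarith) _
    calc fmin * (A.toReal + _) ≤ fmin * (Ks * (2 * τ) ^ (m + 1) + Kc * (2 * τ) ^ (m + 1)) := by
          gcongr
          exact (hb i).trans (by gcongr)
      _ = (fmin * τ ^ (m + 1)) * ((Ks + Kc) * 2 ^ (m + 1)) := by rw [mul_pow]; ring
      _ ≤ 1 / ((Ks + Kc) * 2 ^ (m + 1)) * ((Ks + Kc) * 2 ^ (m + 1)) := by gcongr
      _ = 1 := by field_simp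
  · calc (1 : ℝ) = 1 / (2 ^ (m + 1) * ω) * (2 ^ (m + 1) * ω) := by field_simp
      _ ≤ fmax * τ ^ (m + 1) * (2 ^ (m + 1) * ω) := by gcongr
      _ = fmax * ((2 * τ) ^ (m + 1) * ω) := by rw [mul_pow]; ring
      _ ≤ fmax * A.toReal := mul_le_mul_of_nonneg_left ha1 (hf.le.trans hff)
  · intro i
    have h1 : κ ^ (m + 1) ≤ κ := pow_le_of_le_one hκ0.le hκ1 (by omega)
    calc fmin * _ ≤ fmin * (Kc * δ ^ (m + 1)) := mul_le_mul_of_nonneg_left (hb i) hf.le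
      _ = Kc * κ ^ (m + 1) * (fmin * τ ^ (m + 1)) * y ^ (m + 1) := by
          rw [hδ, mul_pow, mul_pow]; ring
      _ ≤ 1 / 2 * (fmin * τ ^ (m + 1)) * (1 / (fmin * τ ^ (m + 1) * (n : ℝ))) := by
          gcongr
          exact le_trans (by gcongr) hκ2
      _ = 1 / (2 * n) := by field_simp

/-- Lower bound for manifolds with boundary: a ball and a convex body obtained from it by pushing
out a small part of its boundary. -/
theorem exists_le_minimaxRisk_boundary (m : ℕ) :
    ∃ c c' C : ℝ, 0 < c ∧ 0 < c' ∧ 0 < C ∧ ∀ (D : ℕ) (fmin fmax : ℝ), 0 < fmin → fmin ≤ fmax →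
      m + 1 ≤ D → ∀ (τmin : ℝ≥0∞) (τ : ℝ), 0 < τ → fmin ≤ c / τ ^ (m + 1) →
        c' / τ ^ (m + 1) ≤ fmax → ∀ n : ℕ, 1 ≤ n →
          ENNReal.ofReal (C * τ *
              min 1 ((1 / (fmin * τ ^ (m + 1) * (n : ℝ))) ^ ((2 : ℝ) / ((m + 1 + 1 : ℕ) : ℝ)))) ≤
            minimaxRisk (statisticalModel (m + 1) D τmin (ENNReal.ofReal τ) fmin fmax) n := by
  obtain ⟨a₀, ha₀, hbump⟩ := exists_isSmallBump (Ambient (m + 1))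
  set ω := unitBallVolume (m + 1)
  have hω : 0 < ω := unitBallVolume_pos _
  -- `κ` is small enough for a bump of width `κ τ y` to have volume at most `1 / (2 n fmin)`.
  set κ : ℝ := 1 / 2 ^ (m + 1) with hκ
  have hκ0 : 0 < κ := by positivity
  have hκ1 : κ ≤ 1 := by
    rw [hκ, div_le_one (by positivity)]
    exact one_le_pow₀ one_le_two
  refine ⟨1 / ((ω + 1) * 2 ^ (m + 1)), 1 / (2 ^ (m + 1) * ω), a₀ * κ ^ 2 / 24, by positivity,
    by positivity, by positivity, ?_⟩
  intro D fmin fmax hf hff hm τmin τ hτ hfc hfc' n hn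
  have hn' : (1 : ℝ) ≤ n := by exact_mod_cast hn
  rw [le_div_iff₀ (by positivity)] at hfc
  rw [div_le_iff₀ (by positivity)] at hfc'
  obtain ⟨y, hy0, hy1, hyx, hy2⟩ := exists_pow_le_of_pos (e := m + 1 + 1) (by omega)
    (x := 1 / (fmin * τ ^ (m + 1) * (n : ℝ))) (by positivity)
  rw [← hy2]
  set δ := κ * τ * y with hδ
  have hδ0 : 0 < δ := by positivity
  have hδτ : δ ≤ τ := by
    calc κ * τ * y ≤ 1 * τ * 1 := by gcongr
      _ = τ := by ring
  obtain ⟨ψ, hψ, hψa⟩ := hbump (pole m (2 * τ)) δ hδ0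
  let ψs : Fin 2 → Ambient (m + 1) → ℝ := ![fun _ => 0, ψ]
  have hψs : ∀ i, IsSmallBump (pole m (2 * τ)) δ (ψs i) := by
    intro i
    fin_cases i
    · exact isSmallBump_zero _ hδ0.le
    · exact hψ
  let M : Fin 2 → Set (Ambient D) := fun i => incl hm '' {x | profile (2 * τ) (ψs i) x ≤ 0}
  set U : Set (Ambient D) := (incl hm '' Metric.closedBall 0 (2 * τ))ᶜ with hU
  have hUm : MeasurableSet U :=
    ((isCompact_closedBall _ _).image (incl hm).continuous).isClosed.measurableSet.compl
  have hUpre : incl hm ⁻¹' U = (Metric.closedBall 0 (2 * τ))ᶜ := by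
    rw [hU, preimage_compl, preimage_image_eq _ (incl hm).injective]
  have hdiff : ∀ i, M i \ U = incl hm '' Metric.closedBall 0 (2 * τ) := by
    intro i
    rw [← image_sdiff_preimage, hUpre, sdiff_compl, inter_eq_right.2]
    exact fun x hx => (hψs i).profile_nonpos_of_norm_le (mem_closedBall_zero_iff.1 hx)
  have hinter : ∀ i, M i ∩ U = incl hm ''
      ({x | profile (2 * τ) (ψs i) x ≤ 0} \ Metric.closedBall 0 (2 * τ)) := by
    intro i
    rw [← image_inter_preimage, hUpre, sdiff_eq]
  have hA : (μHE[m + 1] : Measure (Ambient D)) (M 0 \ U) =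
      ENNReal.ofReal ((2 * τ) ^ (m + 1) * ω) := by
    rw [hdiff, euclideanHausdorffMeasure_image_incl, volume_closedBall_eq _ (by positivity)]
  have hB : ∀ i, (μHE[m + 1] : Measure (Ambient D)) (M i ∩ U) ≤
      ENNReal.ofReal (δ ^ 2 / (4 * (2 * τ)) * (2 * δ) ^ m) := by
    intro i
    rw [hinter, euclideanHausdorffMeasure_image_incl]
    exact (hψs i).volume_sublevel_diff_le hδ0 (by linarith)
  have hBfin : ∀ i, (μHE[m + 1] : Measure (Ambient D)) (M i ∩ U) ≠ ⊤ := fun i =>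
    ne_top_of_le_ne_top ENNReal.ofReal_ne_top (hB i)
  have hb : ∀ i, ((μHE[m + 1] : Measure (Ambient D)) (M i ∩ U)).toReal ≤
      δ ^ 2 / (4 * (2 * τ)) * (2 * δ) ^ m :=
    fun i => ENNReal.toReal_le_of_le_ofReal (by positivity) (hB i)
  have hMg : ∀ i, M i ∈ geometricModel (m + 1) D τmin (ENNReal.ofReal τ) := fun i =>
    (hψs i).image_sublevel_mem_geometricModel hδ0.le (by linarith) hτ hm τmin
  have hmain := hausdorffEDist_div_four_le_of_diff_eq (d := m + 1) (U := U) (M := M)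
    (Model := statisticalModel (m + 1) D τmin (ENNReal.ofReal τ) fmin fmax)
    (τ := τmin) (τb := ENNReal.ofReal τ) (fmin := fmin) (fmax := fmax) hn
    (a := (2 * τ) ^ (m + 1) * ω)
    (b := fun i => ((μHE[m + 1] : Measure (Ambient D)) (M i ∩ U)).toReal)
    (fun P hP _ _ => hP) hMg
    (fun i p hp V hV => (hMg i).2.2.1.measure_inter_pos hm hp hV)
    hUm (by rw [hdiff, hdiff]) (by positivity) (fun i => ENNReal.toReal_nonneg)
    hA (fun i => (ENNReal.ofReal_toReal (hBfin i)).symm) hf hff ?_ ?_ ?_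
  · refine le_trans (ofReal_le_div_four ?_) hmain
    have h1 := hψ.le_hausdorffEDist hδ0 (by linarith) ha₀ hψa
      (S₀ := {x | profile (2 * τ) (ψs 0) x ≤ 0}) (S₁ := {x | profile (2 * τ) (ψs 1) x ≤ 0})
      (profile_zero_le_iff (by positivity)).subset (fun x hx => le_of_eq hx)
    rw [Metric.hausdorffEDist_image (incl hm).isometry]
    refine le_trans (ENNReal.ofReal_le_ofReal (le_of_eq ?_)) h1
    rw [hδ]
    field_simp
    norm_num
  · intro i
    have h1 : δ ^ 2 / (4 * (2 * τ)) * (2 * δ) ^ m ≤ (2 * τ) ^ (m + 1) := by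
      have h2 : δ ^ 2 / (4 * (2 * τ)) ≤ 2 * τ := by
        rw [div_le_iff₀ (by positivity)]
        nlinarith
      calc _ ≤ 2 * τ * (2 * τ) ^ m := by gcongr
        _ = _ := by ring
    calc fmin * ((2 * τ) ^ (m + 1) * ω + _)
        ≤ fmin * ((2 * τ) ^ (m + 1) * ω + (2 * τ) ^ (m + 1)) := by
          gcongr
          exact (hb i).trans h1
      _ = (fmin * τ ^ (m + 1)) * ((ω + 1) * 2 ^ (m + 1)) := by rw [mul_pow]; ring
      _ ≤ 1 / ((ω + 1) * 2 ^ (m + 1)) * ((ω + 1) * 2 ^ (m + 1)) := by gcongr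
      _ = 1 := by field_simp
  · calc (1 : ℝ) = 1 / (2 ^ (m + 1) * ω) * (2 ^ (m + 1) * ω) := by field_simp
      _ ≤ fmax * τ ^ (m + 1) * (2 ^ (m + 1) * ω) := by gcongr
      _ = fmax * ((2 * τ) ^ (m + 1) * ω) := by rw [mul_pow]; ring
  · intro i
    have h1 : κ ^ (m + 1 + 1) ≤ κ := pow_le_of_le_one hκ0.le hκ1 (by omega)
    have h2 : 2 ^ m / 8 * κ ≤ 1 / 2 := by
      have : (2 : ℝ) ^ m / 8 * κ = 1 / 16 := by
        rw [hκ, pow_succ]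
        field_simp
        norm_num
      rw [this]
      norm_num
    calc fmin * _ ≤ fmin * (δ ^ 2 / (4 * (2 * τ)) * (2 * δ) ^ m) :=
          mul_le_mul_of_nonneg_left (hb i) hf.le
      _ = 2 ^ m / 8 * κ ^ (m + 1 + 1) * (fmin * τ ^ (m + 1)) * y ^ (m + 1 + 1) := by
          rw [hδ]
          field_simp
          ring_nf
      _ ≤ 1 / 2 * (fmin * τ ^ (m + 1)) * (1 / (fmin * τ ^ (m + 1) * (n : ℝ))) := by
          gcongr
          exact le_trans (by gcongr) h2
      _ = 1 / (2 * n) := by field_simp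

end ManifoldEstimation

end

theorem mainTheorem4 (d : ℕ) (hd : 1 ≤ d) :
    ∃ c c' C : ℝ, 0 < c ∧ 0 < c' ∧ 0 < C ∧
      ∀ (D : ℕ) (fmin fmax : ℝ), 0 < fmin → fmin ≤ fmax →
        (d < D → ∀ τmin : ℝ, 0 < τmin → fmin ≤ c / τmin ^ d → c' / τmin ^ d ≤ fmax →
          ∀ n : ℕ, 1 ≤ n →
            ENNReal.ofReal
                (C * τmin * min 1 ((1 / (fmin * τmin ^ d * (n : ℝ))) ^ ((2 : ℝ) / (d : ℝ)))) ≤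
              ManifoldEstimation.minimaxRisk
                (ManifoldEstimation.boundaryless d
                  (ManifoldEstimation.statisticalModel d D
                    (ENNReal.ofReal τmin) ⊤ fmin fmax)) n) ∧
        (d ≤ D → ∀ (τmin : ℝ≥0∞) (τbmin : ℝ), 0 < τmin → 0 < τbmin →
          fmin ≤ c / τbmin ^ d → c' / τbmin ^ d ≤ fmax →
          ∀ n : ℕ, 1 ≤ n →
            ENNReal.ofReal
                (C * τbmin *
                  min 1 ((1 / (fmin * τbmin ^ d * (n : ℝ))) ^ ((2 : ℝ) / ((d : ℝ) + 1)))) ≤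
              ManifoldEstimation.minimaxRisk
                (ManifoldEstimation.statisticalModel d D
                  τmin (ENNReal.ofReal τbmin) fmin fmax) n) := by
  obtain ⟨m, rfl⟩ : ∃ m, d = m + 1 := ⟨d - 1, by omega⟩
  obtain ⟨c₁, c₁', C₁, hc₁, hc₁', hC₁, H₁⟩ :=
    ManifoldEstimation.exists_le_minimaxRisk_boundaryless m
  obtain ⟨c₂, c₂', C₂, hc₂, hc₂', hC₂, H₂⟩ := ManifoldEstimation.exists_le_minimaxRisk_boundary m
  refine ⟨min c₁ c₂, max c₁' c₂', min C₁ C₂, lt_min hc₁ hc₂, lt_max_of_lt_left hc₁',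
    lt_min hC₁ hC₂, fun D fmin fmax hf hff => ⟨?_, ?_⟩⟩
  · intro hD τ hτ h1 h2 n hn
    refine le_trans (ENNReal.ofReal_le_ofReal ?_) (H₁ D fmin fmax hf hff hD τ hτ
      (h1.trans ?_) (le_trans ?_ h2) n hn)
    · gcongr
      exact min_le_left _ _
    · gcongr
      exact min_le_left _ _
    · gcongr
      exact le_max_left _ _
  · intro hD τmin τ _ hτ h1 h2 n hn
    have h3 := H₂ D fmin fmax hf hff hD τmin τ hτ (h1.trans ?_) (le_trans ?_ h2) n hn
    · rw [Nat.cast_add_one (m + 1)] at h3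
      refine le_trans (ENNReal.ofReal_le_ofReal ?_) h3
      gcongr
      exact min_le_right _ _
    · gcongr
      exact min_le_right _ _
    · gcongr
      exact le_max_right _ _
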